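/- **Logic.** Let $L$ be a vocabulary. Formulas are built from atomic formulas $R(\bar t)$ ($R$ a relation symbol, $\bar t$ a tuple of terms in the variables $v_0,v_1,\dots$; no equality, no negation) with $\forall v$, $\exists v$, and conjunctions $\bigwedge\Phi$ and disjunctions $\bigvee\Phi$ of sets $\Phi$ of formulas. Such a formula belongs to $\mathcal L_\kappa$ if each $\Phi$ used has fewer than $\kappa$ elements and the free variables of its elements lie in one finite set. Let $\mathcal K$ be a class of nonempty $L$-structures; $\equiv$ and $\models$ between formulas refer to the structures in $\mathcal K$. **Approximations.** $L$ has approximations for $\mathcal K$: there are a dense set $D\subseteq[0,\infty)$ that contains $0$ and is closed under addition and under differences $\varepsilon-\delta$ with $\varepsilon\ge\delta$, and functions $\mathrm{Appr}(\varphi,\varepsilon)$ ($\varepsilon\in D$) and $\mathrm{neg}(\varphi)$ from atomic formulas to atomic formulas, keeping the variables of $\varphi$, such that for all atomic $\varphi$ and $\varepsilon,\delta\in D$: $\mathrm{Appr}(\varphi,0)\equiv\varphi$; $\mathrm{Appr}(\mathrm{Appr}(\varphi,\varepsilon),\delta)\equiv\mathrm{Appr}(\varphi,\varepsilon+\delta)$;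 $\varphi\models\mathrm{Appr}(\varphi,\varepsilon)$; in every $A\in\mathcal K$ a tuple satisfies $\varphi$ iff it satisfies $\mathrm{Appr}(\varphi,\varepsilon)$ for all $\varepsilon\in D\setminus\{0\}$; $\mathrm{neg}(\mathrm{neg}(\varphi))=\varphi$; a tuple of $A\in\mathcal K$ fails $\varphi$ iff it satisfies $\mathrm{neg}(\mathrm{Appr}(\varphi,\varepsilon))$ for some $\varepsilon\in D\setminus\{0\}$, and a tuple that fails $\varphi$ satisfies $\mathrm{neg}(\varphi)$; $\mathrm{Appr}(\mathrm{neg}(\mathrm{Appr}(\varphi,\varepsilon)),\delta)\equiv\mathrm{neg}(\mathrm{Appr}(\varphi,\varepsilon-\delta))$ if $\varepsilon\ge\delta>0$. Moreover each $A\in\mathcal K$ carries a complete metric $d_A$ such that for each $r\in D\setminus\{0\}$ the relation $d_A(x,y)\le r$ is defined in $A$ by an atomic formula. Density, separability and Cauchy sequences refer to $d_A$. Put $\neg\varphi=\bigvee_{\varepsilon\in D\setminus\{0\}}\mathrm{neg}(\mathrm{Appr}(\varphi,\varepsilon))$ for atomic $\varphi$, extend $\neg$ to all formulas by exchanging $\forall,\exists$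 and $\bigwedge,\bigvee$, and let $\varphi\to\psi$ be $\neg\varphi\vee\psi$. **Isomorphism notion.** For $\varepsilon\in D$ let $\mathcal I_\varepsilon$ be a class of bijections $A\to B$ with $A,B\in\mathcal K$ ($\varepsilon$-isomorphisms) such that $L$-isomorphisms are in $\mathcal I_0$; $f\in\mathcal I_\varepsilon$ implies $f^{-1}\in\mathcal I_\varepsilon$; $f\in\mathcal I_\varepsilon$, $g\in\mathcal I_\delta$ imply $g\circ f\in\mathcal I_{\varepsilon+\delta}$ when defined; $\mathcal I_\varepsilon\subseteq\mathcal I_\delta$ for $\varepsilon\le\delta$; and a surjection $f\colon A\to B$ is in $\mathcal I_\varepsilon$ iff $A\models\varphi(\bar a)$ implies $B\models\mathrm{Appr}(\varphi,\varepsilon)(f(\bar a))$ for all atomic $\varphi$ and all $\bar a$. Let $d_{\mathcal I}(A,B)=\inf\{\varepsilon\in D:\text{there is an }\varepsilon\text{-isomorphism }A\to B\}$, with $\inf\emptyset=\infty$. **Good formulas.** Let $\mathrm{Good}(k)$, $k<\omega$, be sets of atomic formulas such that: every atomic $\varphi$ has some $k$ and $\psi\in\mathrm{Good}(k)$ with $\varphi\equiv\psi$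 and $\mathrm{Appr}(\varphi,\varepsilon)\equiv\mathrm{Appr}(\psi,\varepsilon)$ for all $\varepsilon\in D$; $\mathrm{Good}(k)\subseteq\mathrm{Good}(k+1)$; if $\varphi\in\mathrm{Good}(k)$ and $\varepsilon\in D$, then $\mathrm{Appr}(\varphi,\varepsilon)$ and $\mathrm{neg}(\mathrm{Appr}(\varphi,\varepsilon))$ are in $\mathrm{Good}(\lceil ke^\varepsilon\rceil)$; for all $A\in\mathcal K$, $k$ and $\varepsilon\in D\setminus\{0\}$ there is $\delta>0$ such that $A\models\varphi(\bar a)$ implies $A\models\mathrm{Appr}(\varphi,\varepsilon)(\bar b)$ whenever $\varphi\in\mathrm{Good}(k)$ and $\max_i d_A(a_i,b_i)<\delta$; and if $A,B\in\mathcal K$, $\varepsilon\in D$, $a_n\in A$, $b_n\in B$, $\varepsilon_n\in D\cap(\varepsilon,\infty)$ decreases to $\varepsilon$, and for all $k$, $\varphi\in\mathrm{Good}(k)$ and $i_0,\dots,i_{m-1}\ge k$, $A\models\varphi(a_{i_0},\dots,a_{i_{m-1}})$ implies $B\models\mathrm{Appr}(\varphi,\varepsilon_k)(b_{i_0},\dots,b_{i_{m-1}})$,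 then for each strictly increasing $(i_n)$, $(a_{i_n})_n$ is Cauchy iff $(b_{i_n})_n$ is. **Games.** In $\mathrm{EF}_{\omega,\varepsilon}(A,B)$, in round $k<\omega$ player I picks a point of $A$ or of $B$ and some $\varepsilon_k\in D$ with $\varepsilon_k>\varepsilon$, and II answers with a point of the other structure; let $a_k\in A$, $b_k\in B$ be the points picked. II wins if for all $k$, $\varphi\in\mathrm{Good}(k)$ and $i_0,\dots,i_{m-1}\ge k$, $A\models\varphi(a_{i_0},\dots,a_{i_{m-1}})$ implies $B\models\mathrm{Appr}(\varphi,\varepsilon_k)(b_{i_0},\dots,b_{i_{m-1}})$. For an ordinal $\alpha$, sets $S\subseteq A$, $T\subseteq B$ and tuples $\bar\varepsilon,\bar k,\bar a,\bar b$ of length $n$, the dynamic game with clock $\alpha$ and precision $\varepsilon$ starts with these tuples; in each round I picks a point of $S$ or of $T$, a number in $D\cap(\varepsilon,\infty)$, a number in $\omega$ and an ordinal below $\alpha$ and below all his earlier ordinals, II answers with a point of the other set, and $\bar a,\bar b,\bar\varepsilon,\bar k$ are extended accordingly. The play ends when I has picked the ordinal $0$ (at once if $\alpha=0$). II wins if for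 each $i$, each $\varphi\in\mathrm{Good}(k_i)$ and all $j_0,\dots,j_{m-1}\ge i$, $A\models\varphi(a_{j_0},\dots)$ implies $B\models\mathrm{Appr}(\varphi,\varepsilon_i)(b_{j_0},\dots)$. The watershed is the least $\alpha$ for which I has a winning strategy in this game, and $0$ if there is none. **Scott sentence.** Let $A\in\mathcal K$, let $S\subseteq A$ be a dense set of minimal cardinality, and let $Q\subseteq D$ be dense in $[0,\infty)$ (for example $Q=D$, or the nonnegative rationals if they lie in $D$). The inner Scott rank $\rho$ of $A$ is the supremum of the watersheds of the dynamic games of precision $\varepsilon$ between $S\subseteq A$ and $S\subseteq A$, over all $\varepsilon\in D\setminus\{0\}$, $n<\omega$, $\bar\varepsilon\in(Q\cap(\varepsilon,\infty))^n$, $\bar k\in\omega^n$ and $\bar a,\bar b\in S^n$. Define $\psi^{\alpha}_{\varepsilon;\bar\varepsilon,\bar k,\bar a}(v_0,\dots,v_{n-1})$ as follows: for $\alpha=0$ it is the conjunction of all $\mathrm{Appr}(\varphi,\varepsilon_i)(v_{j_0},\dots,v_{j_{m-1}})$ with $i<n$, $\varphi\in\mathrm{Good}(k_i)$, $i\le j_0,\dots,j_{m-1}<n$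 and $A\models\varphi(a_{j_0},\dots,a_{j_{m-1}})$; for $\alpha=\beta+1$ it is $$\bigwedge_{\varepsilon_n\in D\cap(\varepsilon,\infty)}\ \bigwedge_{k_n<\omega}\Big(\bigwedge_{a_n\in S}\exists v_n\,\psi^{\beta}_{\varepsilon;\bar\varepsilon\varepsilon_n,\bar kk_n,\bar aa_n}\ \wedge\ \forall v_n\bigvee_{a_n\in S}\psi^{\beta}_{\varepsilon;\bar\varepsilon\varepsilon_n,\bar kk_n,\bar aa_n}\Big);$$ for limit $\alpha$ it is $\bigwedge_{\beta<\alpha}\psi^{\beta}_{\varepsilon;\bar\varepsilon,\bar k,\bar a}$. Let $$\sigma^A_{0^+}=\bigwedge_{\varepsilon}\Big(\psi^{\rho}_{\varepsilon}\wedge\bigwedge_{n}\ \bigwedge_{\bar\varepsilon,\,\bar k,\,\varepsilon^+,\,\bar\varepsilon^+,\,\bar a}\forall v_0\dots\forall v_{n-1}\big(\psi^{\rho}_{\varepsilon;\bar\varepsilon,\bar k,\bar a}\to\psi^{\rho+1}_{\varepsilon^+;\bar\varepsilon^+,\bar k,\bar a}\big)\Big),$$ where $\varepsilon\in D\setminus\{0\}$,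 $n<\omega$, $\bar\varepsilon\in(D\cap(\varepsilon,\infty))^n$, $\bar k\in\omega^n$, $\varepsilon^+\in D\cap(\varepsilon,\infty)$, $\bar a\in S^n$, and $\bar\varepsilon^+\in D^n$ with $\varepsilon^+_i>\varepsilon^+$ and $\varepsilon^+_i>\varepsilon_i$ for all $i<n$. **Theorem.** Let $A,B\in\mathcal K$. 1. $B\models\sigma^A_{0^+}$ if and only if II has a winning strategy in $\mathrm{EF}_{\omega,\varepsilon}(A,B)$ for every real $\varepsilon>0$. 2. If $A$ and $B$ are separable, then $B\models\sigma^A_{0^+}$ if and only if for every $\varepsilon\in D\setminus\{0\}$ there is an $\varepsilon$-isomorphism $A\to B$, and also if and only if $d_{\mathcal I}(A,B)=0$. 3. If $A$ is separable and $L$ and $D$ are countable, then $\sigma^A_{0^+}$ is a sentence of $\mathcal L_{\omega_1}$. -/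

import Mathlib

open CategoryTheory Filter Topology
open scoped Cardinal Ordinal ENNReal

universe u

noncomputable section

namespace MetricScott

/-! ## Atomic formulas and infinitary formulas without negation and equality -/

/-- An atomic formula `R(t₁,…,tₙ)`: a relation symbol applied to terms in the variables
`v₀, v₁, …`. -/
structure Atom (L : FirstOrder.Language.{u, u}) : Type u where
  arity : ℕ
  rel : L.Relations arity
  args : Fin arity → L.Term ℕ

namespace Atom

variable {L : FirstOrder.Language.{u, u}}

/-- The indices of the variables that occur in an atomic formula. -/
def vars (φ : Atom L) : Set ℕ := {x | ∃ i, x ∈ (φ.args i).varFinset}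

/-- Satisfaction of an atomic formula when `vₓ` has the value `v x`. -/
def Realize (φ : Atom L) {M : Type u} [L.Structure M] (v : ℕ → M) : Prop :=
  FirstOrder.Language.Structure.RelMap φ.rel fun i => (φ.args i).realize v

/-- The atomic formula `φ(v_{j 0}, v_{j 1}, …)`. -/
def rename (φ : Atom L) (j : ℕ → ℕ) : Atom L where
  arity := φ.arity
  rel := φ.rel
  args := fun i => (φ.args i).relabel j

end Atom

/-- Infinitary formulas: atomic formulas, quantifiers, and conjunctions and disjunctions of
families of formulas of any size. -/
inductive Formula (L : FirstOrder.Language.{u, u}) : Type (u + 1)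
  | atom (φ : Atom L) : Formula L
  | all (x : ℕ) (φ : Formula L) : Formula L
  | ex (x : ℕ) (φ : Formula L) : Formula L
  | conj (ι : Type u) (φ : ι → Formula L) : Formula L
  | disj (ι : Type u) (φ : ι → Formula L) : Formula L

namespace Formula

variable {L : FirstOrder.Language.{u, u}}

/-- The indices of the free variables. -/
def free : Formula L → Set ℕ
  | atom φ => φ.vars
  | all x φ => φ.free \ {x}
  | ex x φ => φ.free \ {x}
  | conj _ φ => ⋃ i, (φ i).free
  | disj _ φ => ⋃ i, (φ i).free

/-- Satisfaction, in the usual way. -/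
def Realize {M : Type u} [L.Structure M] : Formula L → (ℕ → M) → Prop
  | atom φ, v => φ.Realize v
  | all x φ, v => ∀ a : M, φ.Realize (Function.update v x a)
  | ex x φ, v => ∃ a : M, φ.Realize (Function.update v x a)
  | conj _ φ, v => ∀ i, (φ i).Realize v
  | disj _ φ, v => ∃ i, (φ i).Realize v

/-- The formula belongs to the logic `L_κ`: every conjunction and disjunction in it is over a set
of fewer than `κ` formulas whose free variables all lie in one finite set. -/
def InLogic (κ : Cardinal.{u + 1}) : Formula L → Prop
  | atom _ => True
  | all _ φ => φ.InLogic κ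
  | ex _ φ => φ.InLogic κ
  | conj _ φ => #(Set.range φ) < κ ∧ (∃ V : Finset ℕ, ∀ i, (φ i).free ⊆ V) ∧
      ∀ i, (φ i).InLogic κ
  | disj _ φ => #(Set.range φ) < κ ∧ (∃ V : Finset ℕ, ∀ i, (φ i).free ⊆ V) ∧
      ∀ i, (φ i).InLogic κ

/-- A sentence of the logic `L_κ`. -/
def IsSentenceOf (κ : Cardinal.{u + 1}) (φ : Formula L) : Prop :=
  φ.InLogic κ ∧ φ.free = ∅

/-- A structure satisfies a sentence. -/
def Models (M : Type u) [L.Structure M] (φ : Formula L) : Prop :=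
  ∀ v : ℕ → M, φ.Realize v

/-- Conjunction of a family whose index type lies in the lowest universe. -/
def conjSmall {ι : Type} (φ : ι → Formula L) : Formula L :=
  conj (ULift.{u} ι) fun i => φ i.down

/-- Disjunction of a family whose index type lies in the lowest universe. -/
def disjSmall {ι : Type} (φ : ι → Formula L) : Formula L :=
  disj (ULift.{u} ι) fun i => φ i.down

/-- `φ ∧ ψ` -/
def and (φ ψ : Formula L) : Formula L := conjSmall fun b : Bool => cond b φ ψ

/-- `φ ∨ ψ` -/
def or (φ ψ : Formula L) : Formula L := disjSmall fun b : Bool => cond b φ ψ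

/-- `∀ v₀ … ∀ v_{n-1} φ` -/
def allFirst : ℕ → Formula L → Formula L
  | 0, φ => φ
  | n + 1, φ => allFirst n (all n φ)

end Formula

/-! ## Vocabularies with approximations -/

/-- The vocabulary `L` has approximations for the class `K` of (nonempty) `L`-structures.
The operation `appr φ ε` is meaningful only for `ε ∈ D`. Equivalence of atomic formulas is
equivalence in all structures of `K`. -/
structure Approximations (L : FirstOrder.Language.{u, u}) (K : Set (Bundled.{u} L.Structure)) where
  nonempty : ∀ A : K, Nonempty A.1
  D : Set ℝ
  D_nonneg : ∀ ε ∈ D, 0 ≤ ε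
  D_dense : ∀ x y : ℝ, 0 ≤ x → x < y → ∃ ε ∈ D, x < ε ∧ ε < y
  zero_mem : (0 : ℝ) ∈ D
  add_mem : ∀ ε ∈ D, ∀ δ ∈ D, ε + δ ∈ D
  sub_mem : ∀ ε ∈ D, ∀ δ ∈ D, δ ≤ ε → ε - δ ∈ D
  appr : Atom L → ℝ → Atom L
  neg : Atom L → Atom L
  vars_appr : ∀ φ, ∀ ε ∈ D, (appr φ ε).vars = φ.vars
  appr_zero : ∀ φ, ∀ A : K, ∀ v : ℕ → A.1, (appr φ 0).Realize v ↔ φ.Realize v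
  appr_appr : ∀ φ, ∀ ε ∈ D, ∀ δ ∈ D, ∀ A : K, ∀ v : ℕ → A.1,
    (appr (appr φ ε) δ).Realize v ↔ (appr φ (ε + δ)).Realize v
  realize_appr : ∀ φ, ∀ ε ∈ D, ∀ A : K, ∀ v : ℕ → A.1, φ.Realize v → (appr φ ε).Realize v
  realize_iff : ∀ φ, ∀ A : K, ∀ v : ℕ → A.1,
    φ.Realize v ↔ ∀ ε ∈ D, 0 < ε → (appr φ ε).Realize v
  vars_neg : ∀ φ, (neg φ).vars = φ.vars
  neg_neg : ∀ φ, neg (neg φ) = φ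
  not_realize_iff : ∀ φ, ∀ A : K, ∀ v : ℕ → A.1,
    ¬ φ.Realize v ↔ ∃ ε ∈ D, 0 < ε ∧ (neg (appr φ ε)).Realize v
  realize_neg : ∀ φ, ∀ A : K, ∀ v : ℕ → A.1, ¬ φ.Realize v → (neg φ).Realize v
  appr_neg_appr : ∀ φ, ∀ ε ∈ D, ∀ δ ∈ D, 0 < δ → δ ≤ ε → ∀ A : K, ∀ v : ℕ → A.1,
    (appr (neg (appr φ ε)) δ).Realize v ↔ (neg (appr φ (ε - δ))).Realize v
  metric : ∀ A : K, MetricSpace A.1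
  complete : ∀ A : K, letI := metric A; CompleteSpace A.1
  definable : ∀ A : K, ∀ r ∈ D, 0 < r → ∃ φ : Atom L, φ.vars ⊆ {0, 1} ∧
    ∀ v : ℕ → A.1, φ.Realize v ↔ (letI := metric A; dist (v 0) (v 1) ≤ r)

namespace Approximations

variable {L : FirstOrder.Language.{u, u}} {K : Set (Bundled.{u} L.Structure)}
  (V : Approximations L K)

/-- Density in the sense of the metric of the structure. -/
def IsDense (A : K) (S : Set A.1) : Prop := letI := V.metric A; Dense S

/-- A dense set of minimal cardinality. -/
def IsMinimalDense (A : K) (S : Set A.1) : Prop :=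
  V.IsDense A S ∧ ∀ T : Set A.1, V.IsDense A T → #S ≤ #T

/-- Separability in the sense of the metric of the structure. -/
def IsSeparable (A : K) : Prop := letI := V.metric A; TopologicalSpace.SeparableSpace A.1

/-- Cauchy sequences in the sense of the metric of the structure. -/
def IsCauchy (A : K) (s : ℕ → A.1) : Prop := letI := V.metric A; CauchySeq s

/-- The negation of a formula, in negation normal form: the negation of an atomic `φ` is the
disjunction of the weak negations of its approximations. -/
def not : Formula L → Formula L
  | .atom φ => .disjSmall fun ε : {ε : ℝ // ε ∈ V.D ∧ 0 < ε} => .atom (V.neg (V.appr φ ε))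
  | .all x φ => .ex x (not φ)
  | .ex x φ => .all x (not φ)
  | .conj ι φ => .disj ι fun i => not (φ i)
  | .disj ι φ => .conj ι fun i => not (φ i)

/-- `φ → ψ` -/
def imp (φ ψ : Formula L) : Formula L := (V.not φ).or ψ

end Approximations

/-! ## Isomorphism notions and good vocabularies -/

/-- An isomorphism notion of `K`: `mem ε A B` is the set of `ε`-isomorphisms `A → B`,
for `ε ∈ D`. -/
structure IsoNotion {L : FirstOrder.Language.{u, u}} {K : Set (Bundled.{u} L.Structure)}
    (V : Approximations L K) where
  mem : ℝ → ∀ A B : K, Set (A.1 → B.1)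
  bijective : ∀ ε ∈ V.D, ∀ A B : K, ∀ f ∈ mem ε A B, Function.Bijective f
  of_equiv : ∀ A B : K, ∀ f : L.Equiv A.1 B.1, ⇑f ∈ mem 0 A B
  symm : ∀ ε ∈ V.D, ∀ A B : K, ∀ f : A.1 ≃ B.1, ⇑f ∈ mem ε A B → ⇑f.symm ∈ mem ε B A
  comp : ∀ ε ∈ V.D, ∀ δ ∈ V.D, ∀ A B C : K, ∀ f ∈ mem ε A B, ∀ g ∈ mem δ B C,
    g ∘ f ∈ mem (ε + δ) A C
  mono : ∀ ε ∈ V.D, ∀ δ ∈ V.D, ε ≤ δ → ∀ A B : K, mem ε A B ⊆ mem δ A B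
  mem_iff : ∀ ε ∈ V.D, ∀ A B : K, ∀ f : A.1 → B.1, Function.Surjective f →
    (f ∈ mem ε A B ↔ ∀ φ : Atom L, ∀ v : ℕ → A.1,
      φ.Realize v → (V.appr φ ε).Realize fun x => f (v x))

/-- The distance `d_I(A,B)`: the infimum of all `ε` for which there is an `ε`-isomorphism, and
`∞` if there is none. -/
def IsoNotion.isoDist {L : FirstOrder.Language.{u, u}} {K : Set (Bundled.{u} L.Structure)}
    {V : Approximations L K} (I : IsoNotion V) (A B : K) : ℝ≥0∞ :=
  ⨅ ε ∈ {ε : ℝ | ε ∈ V.D ∧ ∃ f, f ∈ I.mem ε A B}, ENNReal.ofReal ε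

/-- Sets of `k`-good formulas that make `L` a good vocabulary. -/
structure GoodSets {L : FirstOrder.Language.{u, u}} {K : Set (Bundled.{u} L.Structure)}
    (V : Approximations L K) where
  Good : ℕ → Set (Atom L)
  exists_good : ∀ φ : Atom L, ∃ k, ∃ ψ ∈ Good k, ∀ A : K, ∀ v : ℕ → A.1,
    (φ.Realize v ↔ ψ.Realize v) ∧
      ∀ ε ∈ V.D, ((V.appr φ ε).Realize v ↔ (V.appr ψ ε).Realize v)
  mono : ∀ k, Good k ⊆ Good (k + 1)
  appr_mem : ∀ k, ∀ ε ∈ V.D, ∀ φ ∈ Good k,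
    V.appr φ ε ∈ Good ⌈(k : ℝ) * Real.exp ε⌉₊ ∧ V.neg (V.appr φ ε) ∈ Good ⌈(k : ℝ) * Real.exp ε⌉₊
  perturbation : ∀ A : K, ∀ k, ∀ ε ∈ V.D, 0 < ε → ∃ δ > 0, ∀ φ ∈ Good k, ∀ v w : ℕ → A.1,
    (∀ x ∈ φ.vars, letI := V.metric A; dist (v x) (w x) < δ) →
      φ.Realize v → (V.appr φ ε).Realize w
  cauchy : ∀ A B : K, ∀ ε ∈ V.D, ∀ (a : ℕ → A.1) (b : ℕ → B.1) (e : ℕ → ℝ),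
    (∀ n, e n ∈ V.D ∧ ε < e n) → Antitone e → Tendsto e atTop (𝓝 ε) →
    (∀ k, ∀ φ ∈ Good k, ∀ i : ℕ → ℕ, (∀ x, k ≤ i x) →
      φ.Realize (fun x => a (i x)) → (V.appr φ (e k)).Realize fun x => b (i x)) →
    ∀ s : ℕ → ℕ, StrictMono s → (V.IsCauchy A (a ∘ s) ↔ V.IsCauchy B (b ∘ s))

/-! ## Two-player games -/

/-- A two-player game of perfect information of length at most `ω`: in each round first `I` plays
an element of `X` and then `II` answers with an element of `Y`. A player without a legal move
loses. -/
structure Game (X Y : Type*) where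
  legalI : List (X × Y) → X → Prop
  legalII : List (X × Y) → X → Y → Prop
  /-- The play has ended. -/
  ended : List (X × Y) → Prop
  /-- `II` wins a play that has ended. -/
  winsFin : List (X × Y) → Prop
  /-- `II` wins an infinite play. -/
  winsInf : (ℕ → X × Y) → Prop

namespace Game

variable {X Y : Type*} (G : Game X Y)

/-- Finite sequences of rounds played by the rules. -/
def IsPlay (h : List (X × Y)) : Prop :=
  ∀ (i : ℕ) (hi : i < h.length), ¬ G.ended (h.take i) ∧
    G.legalI (h.take i) h[i].1 ∧ G.legalII (h.take i) h[i].1 h[i].2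

/-- The moves of `I` follow the strategy `ρ`. -/
def FollowsI (ρ : List (X × Y) → X) (h : List (X × Y)) : Prop :=
  ∀ (i : ℕ) (hi : i < h.length), h[i].1 = ρ (h.take i)

/-- The moves of `II` follow the strategy `τ`. -/
def FollowsII (τ : List (X × Y) → X → Y) (h : List (X × Y)) : Prop :=
  ∀ (i : ℕ) (hi : i < h.length), h[i].2 = τ (h.take i) h[i].1

/-- The first `n` rounds of an infinite play. -/
def firstRounds (p : ℕ → X × Y) (n : ℕ) : List (X × Y) := List.ofFn fun i : Fin n => p i

/-- `I` has a winning strategy. -/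
def IWins : Prop :=
  ∃ ρ : List (X × Y) → X,
    (∀ h, G.IsPlay h → FollowsI ρ h → ¬ G.ended h → G.legalI h (ρ h)) ∧
    (∀ h, G.IsPlay h → FollowsI ρ h → G.ended h → ¬ G.winsFin h) ∧
    (∀ p, (∀ n, G.IsPlay (firstRounds p n) ∧ FollowsI ρ (firstRounds p n)) → ¬ G.winsInf p)

/-- `II` has a winning strategy. -/
def IIWins : Prop :=
  ∃ τ : List (X × Y) → X → Y,
    (∀ h x, G.IsPlay h → FollowsII τ h → ¬ G.ended h → G.legalI h x → G.legalII h x (τ h x)) ∧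
    (∀ h, G.IsPlay h → FollowsII τ h → G.ended h → G.winsFin h) ∧
    (∀ p, (∀ n, G.IsPlay (firstRounds p n) ∧ FollowsII τ (firstRounds p n)) → G.winsInf p)

end Game

/-- A point together with a precision and a level of goodness. Tuples `ā`, `ε̄`, `k̄` of the same
length are given by a list of these. -/
structure Mark (M : Type u) : Type u where
  pt : M
  eps : ℝ
  lvl : ℕ

/-- A move of `I` in the dynamic game: a point of one of the structures, a precision, a level and
an ordinal. -/
structure DynMove (M N : Type u) : Type (u + 1) where
  pt : M ⊕ N
  eps : ℝ
  lvl : ℕ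
  clock : Ordinal.{u}

/-- `II` answers a point of one structure with a point of the other one. The answer is given as the
pair `(a, b)` that consists of the point and the answer. -/
def Answers {M N : Type u} (x : M ⊕ N) (y : M × N) : Prop :=
  x = Sum.inl y.1 ∨ x = Sum.inr y.2

section Scott

variable {L : FirstOrder.Language.{u, u}} {K : Set (Bundled.{u} L.Structure)}
  {V : Approximations L K} (G : GoodSets V)

/-- The game `EF_{ω,ε}(A,B)`, played in `A` and `B`. -/
def longGame (ε : ℝ) (A B : K) : Game ((A.1 ⊕ B.1) × {e : ℝ // e ∈ V.D ∧ ε < e}) (A.1 × B.1) where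
  legalI _ _ := True
  legalII _ x y := Answers x.1 y
  ended _ := False
  winsFin _ := True
  winsInf p := ∀ k, ∀ φ ∈ G.Good k, ∀ i : ℕ → ℕ, (∀ x, k ≤ i x) →
    φ.Realize (fun x => (p (i x)).2.1) →
      (V.appr φ (p k).1.2).Realize fun x => (p (i x)).2.2

/-- Player `II` has not lost in the position `((a₀,b₀,ε₀,k₀),…,(a_{l-1},b_{l-1},ε_{l-1},k_{l-1}))`
of the dynamic game. -/
def Preserves {A B : K} (P : List (Mark (A.1 × B.1))) : Prop :=
  ∀ i : Fin P.length, ∀ φ ∈ G.Good (P.get i).lvl, ∀ j : ℕ → Fin P.length, (∀ x, i ≤ j x) →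
    φ.Realize (fun x => (P.get (j x)).pt.1) →
      (V.appr φ (P.get i).eps).Realize fun x => (P.get (j x)).pt.2

/-- The dynamic game `EFD_{α,ε}` between `A` and `B`, played in the sets `S` and `T`, with starting
position `P`. -/
def dynGame (α : Ordinal.{u}) (ε : ℝ) {A B : K} (S : Set A.1) (T : Set B.1)
    (P : List (Mark (A.1 × B.1))) : Game (DynMove A.1 B.1) (A.1 × B.1) where
  legalI h x := Sum.elim (· ∈ S) (· ∈ T) x.pt ∧ x.eps ∈ V.D ∧ ε < x.eps ∧
    x.clock < α ∧ ∀ q ∈ h, x.clock < q.1.clock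
  legalII _ x y := Answers x.pt y ∧ y.1 ∈ S ∧ y.2 ∈ T
  ended h := α = 0 ∨ ∃ q ∈ h, q.1.clock = 0
  winsFin h := Preserves G (P ++ h.map fun q => ⟨q.2, q.1.eps, q.1.lvl⟩)
  winsInf _ := True

/-- The Scott watershed: the least ordinal `α` for which `I` wins the dynamic game with clock `α`,
and `0` if there is none. -/
def watershed (ε : ℝ) {A B : K} (S : Set A.1) (T : Set B.1) (P : List (Mark (A.1 × B.1))) :
    Ordinal.{u} :=
  sInf {α | (dynGame G α ε S T P).IWins}

/-- The inner Scott rank of `A`, computed in the set `S ⊆ A` and with the precisions `εᵢ` taken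
from the set `Q ⊆ D`. -/
def innerScottRank (Q : Set ℝ) {A : K} (S : Set A.1) : Ordinal.{u} :=
  ⨆ (ε : {e : ℝ // e ∈ V.D ∧ 0 < e}) (n : ℕ) (e : Fin n → {q : ℝ // q ∈ Q ∧ ε.1 < q})
    (k : Fin n → ℕ) (a : Fin n → S) (b : Fin n → S),
    watershed G (A := A) (B := A) ε S S (List.ofFn fun i => ⟨((a i).1, (b i).1), e i, k i⟩)

/-- The game formula with clock `α` of the tuple `P = ((a₀,ε₀,k₀),…,(a_{n-1},ε_{n-1},k_{n-1}))`
of `A`, in the variables `v₀,…,v_{n-1}`. -/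
def gameFormula (ε : ℝ) {A : K} (S : Set A.1) (α : Ordinal.{u}) : List (Mark A.1) → Formula L :=
  Ordinal.limitRecOn (motive := fun _ => List (Mark A.1) → Formula L) α
    (fun P => .conj
      {q : Fin P.length × Atom L × (ℕ → Fin P.length) //
        q.2.1 ∈ G.Good (P.get q.1).lvl ∧ (∀ x, q.1 ≤ q.2.2 x) ∧
          q.2.1.Realize fun x => (P.get (q.2.2 x)).pt}
      fun q => .atom ((V.appr q.1.2.1 (P.get q.1.1).eps).rename fun x => (q.1.2.2 x : ℕ)))
    (fun _ ψ P => .conjSmall fun e : {e : ℝ // e ∈ V.D ∧ ε < e} => .conjSmall fun k : ℕ =>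
      (Formula.conj S fun a => .ex P.length (ψ (P ++ [⟨a.1, e.1, k⟩]))).and
        (.all P.length (.disj S fun a => ψ (P ++ [⟨a.1, e.1, k⟩]))))
    (fun α _ ψ P => .conj α.ToType fun β => ψ β.toOrd.1 β.toOrd.2 P)

/-- The `0⁺`-Scott sentence of `A`, built with the set `S ⊆ A` (and with `Q` in the rank). -/
def scottSentence (Q : Set ℝ) {A : K} (S : Set A.1) : Formula L :=
  .conjSmall fun ε : {e : ℝ // e ∈ V.D ∧ 0 < e} =>
    (gameFormula G ε S (innerScottRank G Q S) []).and <|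
      .conjSmall fun n : ℕ =>
      .conjSmall fun e : Fin n → {e : ℝ // e ∈ V.D ∧ ε.1 < e} =>
      .conjSmall fun k : Fin n → ℕ =>
      .conjSmall fun ε' : {e : ℝ // e ∈ V.D ∧ ε.1 < e} =>
      .conjSmall fun e' : (i : Fin n) → {d : ℝ // d ∈ V.D ∧ ε'.1 < d ∧ (e i).1 < d} =>
      .conj (Fin n → S) fun a => .allFirst n <|
        V.imp
          (gameFormula G ε S (innerScottRank G Q S)
            (List.ofFn fun i => ⟨(a i).1, (e i).1, k i⟩))
          (gameFormula G ε' S (innerScottRank G Q S + 1)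
            (List.ofFn fun i => ⟨(a i).1, (e' i).1, k i⟩))

end Scott

end MetricScott

end

/-!
The game formula with clock `α` says that `II` does not lose the dynamic game with clock `α`. Once
the clock exceeds the inner Scott rank of `A`, a position inside `A` that `II` survives for the time
`ρ` is one that she survives for the time `ρ + 1`; the Scott sentence transfers this to positions
between `A` and `B`, at the cost of slightly larger precisions. Relaxing the precisions over and
over, she can therefore play forever, so a model `B` of the sentence has back-and-forth systems of
every positive precision with `A`. Conversely such a system lets positions between `A` and `B` be
compared with positions inside `A`, which are governed by `ρ`.

In the long game `II` shadows the play by a position of the system whose points lie in `S`; uniform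
continuity of good formulas makes up for the perturbation, and the requirement `i ≥ k` on the
indices for the growth of the levels under approximation. If the structures are separable and `I`
plays the points of countable dense sets infinitely often each, with precisions decreasing to `ε`,
then a play won by `II` matches convergent subsequences, and passing to limits gives an
`ε`-isomorphism.

With countable data, `I` needs only one countable ordinal to beat each of the countably many answers
to a move, so all watersheds, and with them the rank, are countable.
-/

noncomputable section

namespace MetricScott

namespace Atom

variable {L : FirstOrder.Language.{u, u}} {M : Type u} [L.Structure M]

theorem realize_congr (φ : Atom L) {v w : ℕ → M} (h : ∀ x ∈ φ.vars, v x = w x) :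
    φ.Realize v ↔ φ.Realize w := by
  have hargs : ∀ i, (φ.args i).realize v = (φ.args i).realize w := fun i =>
    (FirstOrder.Language.Term.realize_restrictVar (f := Subtype.val) v fun x =>
      (h x ⟨i, x.2⟩).symm).symm.trans
        (FirstOrder.Language.Term.realize_restrictVar w fun _ => rfl)
  simp only [Realize, hargs]

theorem finite_vars (φ : Atom L) : φ.vars.Finite := by
  have h : φ.vars = ⋃ i, ((φ.args i).varFinset : Set ℕ) := by ext; simp [vars]
  exact h ▸ Set.finite_iUnion fun i => Finset.finite_toSet _

theorem realize_rename (φ : Atom L) (j : ℕ → ℕ) (v : ℕ → M) :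
    (φ.rename j).Realize v ↔ φ.Realize fun x => v (j x) := by
  simp [Realize, rename, FirstOrder.Language.Term.realize_relabel, Function.comp_def]

theorem vars_rename_subset (φ : Atom L) (j : ℕ → ℕ) : (φ.rename j).vars ⊆ Set.range j := by
  have hterm : ∀ t : L.Term ℕ, ((t.relabel j).varFinset : Set ℕ) ⊆ Set.range j := fun t => by
    induction t with
    | var x => simp [FirstOrder.Language.Term.varFinset]
    | func f ts ih => simpa [FirstOrder.Language.Term.varFinset] using ih
  rintro x ⟨i, hx⟩
  exact hterm _ hx

end Atom

namespace Formula

variable {L : FirstOrder.Language.{u, u}} {M : Type u} [L.Structure M]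

theorem realize_conjSmall {ι : Type} (φ : ι → Formula L) (v : ℕ → M) :
    (conjSmall φ).Realize v ↔ ∀ i, (φ i).Realize v := by
  simp [conjSmall, Realize]

theorem realize_disjSmall {ι : Type} (φ : ι → Formula L) (v : ℕ → M) :
    (disjSmall φ).Realize v ↔ ∃ i, (φ i).Realize v := by
  simp [disjSmall, Realize]

theorem realize_and (φ ψ : Formula L) (v : ℕ → M) :
    (φ.and ψ).Realize v ↔ φ.Realize v ∧ ψ.Realize v := by
  simp [and, realize_conjSmall, and_comm]

theorem realize_or (φ ψ : Formula L) (v : ℕ → M) :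
    (φ.or ψ).Realize v ↔ φ.Realize v ∨ ψ.Realize v := by
  simp [or, realize_disjSmall, or_comm]

theorem models_conj {ι : Type u} {φ : ι → Formula L} :
    Models M (conj ι φ) ↔ ∀ i, Models M (φ i) :=
  forall_comm

theorem models_conjSmall {ι : Type} {φ : ι → Formula L} :
    Models M (conjSmall φ) ↔ ∀ i, Models M (φ i) := by
  simp only [Models, realize_conjSmall, forall_comm (α := ι)]

theorem models_and {φ ψ : Formula L} : Models M (φ.and ψ) ↔ Models M φ ∧ Models M ψ := by
  simp only [Models, realize_and, forall_and]

theorem models_allFirst (n : ℕ) (φ : Formula L) : Models M (allFirst n φ) ↔ Models M φ := by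
  induction n generalizing φ with
  | zero => rfl
  | succ n ih =>
    rw [allFirst, ih]
    exact ⟨fun h v => by simpa using h v (v n), fun h v a => h _⟩

end Formula

namespace Approximations

variable {L : FirstOrder.Language.{u, u}} {K : Set (Bundled.{u} L.Structure)}
  (V : Approximations L K)

theorem exists_mem_gt (x : ℝ) : ∃ e ∈ V.D, x < e := by
  obtain ⟨e, he, hx, -⟩ := V.D_dense |x| (|x| + 1) (abs_nonneg x) (lt_add_one _)
  exact ⟨e, he, (le_abs_self x).trans_lt hx⟩

variable {V} {φ : Atom L} {A : K} {v : ℕ → A.1}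

theorem realize_appr_mono {ε δ : ℝ} (hε : ε ∈ V.D) (hδ : δ ∈ V.D) (h : ε ≤ δ)
    (hv : (V.appr φ ε).Realize v) : (V.appr φ δ).Realize v := by
  have hdiff := V.sub_mem δ hδ ε hε h
  simpa using (V.appr_appr φ ε hε _ hdiff A v).1 (V.realize_appr _ _ hdiff A v hv)

theorem realize_appr_of_appr_appr {ε δ ζ : ℝ} (hε : ε ∈ V.D) (hδ : δ ∈ V.D) (hζ : ζ ∈ V.D)
    (h : ε + δ ≤ ζ) (hv : (V.appr (V.appr φ ε) δ).Realize v) : (V.appr φ ζ).Realize v :=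
  realize_appr_mono (V.add_mem _ hε _ hδ) hζ h ((V.appr_appr φ ε hε δ hδ A v).1 hv)

variable (V A)

theorem realize_not (φ : Formula L) (v : ℕ → A.1) : (V.not φ).Realize v ↔ ¬ φ.Realize v := by
  induction φ generalizing v with
  | atom φ =>
    simp [not, Formula.realize_disjSmall, Formula.Realize, V.not_realize_iff φ A v, and_assoc]
  | all x φ ih => simp [not, Formula.Realize, ih]
  | ex x φ ih => simp [not, Formula.Realize, ih]
  | conj ι φ ih => simp [not, Formula.Realize, ih]
  | disj ι φ ih => simp [not, Formula.Realize, ih]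

theorem realize_imp (φ ψ : Formula L) (v : ℕ → A.1) :
    (V.imp φ ψ).Realize v ↔ (φ.Realize v → ψ.Realize v) := by
  rw [imp, Formula.realize_or, V.realize_not, imp_iff_not_or]

end Approximations

section ApproxPreserves

variable {L : FirstOrder.Language.{u, u}} {K : Set (Bundled.{u} L.Structure)}
  {V : Approximations L K} {A B C : K}

/-- Approximate negation is an order-reversing involution up to precision, so imitating
`neg (Appr(φ, ζ))` in one direction gives the imitation of `φ` in the other one. -/
theorem Approximations.realize_appr_of_reverse {φ : Atom L} {ζ ξ : ℝ} (hζ : ζ ∈ V.D) (hξ : ξ ∈ V.D)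
    (h0 : 0 < ξ) (hξζ : ξ < ζ) {v : ℕ → A.1} {w : ℕ → B.1}
    (h : (V.neg (V.appr φ ζ)).Realize v → (V.appr (V.neg (V.appr φ ζ)) ξ).Realize w)
    (hw : φ.Realize w) : (V.appr φ ζ).Realize v := by
  by_contra hv
  have hneg := (V.appr_neg_appr φ ζ hζ ξ hξ h0 hξζ.le B w).1 (h (V.realize_neg _ A v hv))
  exact (V.not_realize_iff φ B w).2 ⟨ζ - ξ, V.sub_mem _ hζ _ hξ hξζ.le, sub_pos.2 hξζ, hneg⟩ hw

variable (G : GoodSets V)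

theorem GoodSets.good_mono : Monotone G.Good :=
  monotone_nat_of_le_succ G.mono

theorem GoodSets.appr_mem_of_le {k m : ℕ} {ε : ℝ} (hε : ε ∈ V.D) {φ : Atom L}
    (hφ : φ ∈ G.Good k) (h : (k : ℝ) * Real.exp ε ≤ m) : V.appr φ ε ∈ G.Good m :=
  G.good_mono (Nat.ceil_le.2 h) (G.appr_mem k ε hε φ hφ).1

/-- The family `b` imitates the family `a`: if a formula in `Good (k i)` holds of entries of `a`
whose indices are at least `i`, then its approximation of precision `e i` holds of the corresponding
entries of `b`. This is the winning condition of `II` in the long game (with `k = id`) and in the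
dynamic game (with a finite index set). -/
def ApproxPreserves {ι : Type*} [LE ι] (a : ι → A.1) (b : ι → B.1) (e : ι → ℝ) (k : ι → ℕ) :
    Prop :=
  ∀ i, ∀ φ ∈ G.Good (k i), ∀ j : ℕ → ι, (∀ x, i ≤ j x) →
    φ.Realize (fun x => a (j x)) → (V.appr φ (e i)).Realize fun x => b (j x)

/-- A uniform modulus of perturbation in `A`: moving points by less than `δ k` changes the truth
of the formulas in `Good k` only up to the precision `ξ`. -/
def IsModulus (A : K) (ξ : ℝ) (δ : ℕ → ℝ) : Prop :=
  ∀ k, 0 < δ k ∧ ∀ φ ∈ G.Good k, ∀ v w : ℕ → A.1,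
    (∀ x ∈ φ.vars, (V.metric A).dist (v x) (w x) < δ k) → φ.Realize v → (V.appr φ ξ).Realize w

/-- The family `a'` is a perturbation of `a`: entries whose indices are at least `i` move by less
than `δ (k i)`, as little as a modulus `δ` requires for formulas in `Good (k i)`. -/
def IsPerturbation (V : Approximations L K) {A : K} {ι : Type*} [LE ι] (δ : ℕ → ℝ)
    (a a' : ι → A.1) (k : ι → ℕ) : Prop :=
  ∀ i j, i ≤ j → (V.metric A).dist (a j) (a' j) < δ (k i)

theorem exists_isModulus (A : K) {ξ : ℝ} (hξ : ξ ∈ V.D) (h0 : 0 < ξ) : ∃ δ, IsModulus G A ξ δ := by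
  choose δ hδ h using fun k => G.perturbation A k ξ hξ h0
  exact ⟨δ, fun k => ⟨hδ k, h k⟩⟩

variable {G} {ι κ : Type*} {a a' : ι → A.1} {b : ι → B.1} {c : ι → C.1} {e e₁ e₂ : ι → ℝ}
  {k l : ι → ℕ}

theorem IsModulus.approxPreserves [LE ι] {ξ : ℝ} {δ : ℕ → ℝ} (hδ : IsModulus G A ξ δ)
    (h : IsPerturbation V δ a a' k) : ApproxPreserves G a a' (fun _ => ξ) k :=
  fun i φ hφ j hj => (hδ (k i)).2 φ hφ _ _ fun x _ => h i (j x) (hj x)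

namespace ApproxPreserves

theorem comp [LE ι] [LE κ] (h : ApproxPreserves G a b e k) (f g : κ → ι)
    (hgf : ∀ i j, i ≤ j → g i ≤ f j) :
    ApproxPreserves G (fun i => a (f i)) (fun i => b (f i)) (fun i => e (g i)) fun i => k (g i) :=
  fun i φ hφ j hj => h (g i) φ hφ (fun x => f (j x)) fun x => hgf i (j x) (hj x)

theorem mono [LE ι] (h : ApproxPreserves G a b e₁ k) (he₁ : ∀ i, e₁ i ∈ V.D) (he : ∀ i, e i ∈ V.D)
    (hle : ∀ i, e₁ i ≤ e i) : ApproxPreserves G a b e k :=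
  fun i φ hφ j hj ha =>
    Approximations.realize_appr_mono (he₁ i) (he i) (hle i) (h i φ hφ j hj ha)

theorem trans [LE ι] (hab : ApproxPreserves G a b e₁ k) (hbc : ApproxPreserves G b c e₂ l)
    (he₁ : ∀ i, e₁ i ∈ V.D) (he₂ : ∀ i, e₂ i ∈ V.D) (he : ∀ i, e i ∈ V.D)
    (hadd : ∀ i, e₁ i + e₂ i ≤ e i) (hl : ∀ i, (k i : ℝ) * Real.exp (e₁ i) ≤ l i) :
    ApproxPreserves G a c e k :=
  fun i φ hφ j hj ha => Approximations.realize_appr_of_appr_appr (he₁ i) (he₂ i) (he i) (hadd i)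
    (hbc i _ (G.appr_mem_of_le (he₁ i) hφ (hl i)) j hj (hab i φ hφ j hj ha))

theorem symm [LE ι] (h : ApproxPreserves G a b e₁ fun i => ⌈(k i : ℝ) * Real.exp (e i)⌉₊)
    (he₁ : ∀ i, e₁ i ∈ V.D) (hpos : ∀ i, 0 < e₁ i) (he : ∀ i, e i ∈ V.D) (hlt : ∀ i, e₁ i < e i) :
    ApproxPreserves G b a e k :=
  fun i φ hφ j hj => Approximations.realize_appr_of_reverse (he i) (he₁ i) (hpos i) (hlt i)
    (h i _ (G.appr_mem _ _ (he i) φ hφ).2 j hj)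

theorem of_forall_fin {a : ℕ → A.1} {b : ℕ → B.1} {e : ℕ → ℝ} {k : ℕ → ℕ} (he : ∀ i, e i ∈ V.D)
    (h : ∀ n, ApproxPreserves G (fun i : Fin n => a i) (fun i => b i) (fun i => e i)
      fun i => k i) :
    ApproxPreserves G a b e k := by
  intro i φ hφ j hj ha
  obtain ⟨N, hN⟩ := ((φ.finite_vars.image j).insert i).bddAbove
  have hi : i ≤ N := hN (Set.mem_insert _ _)
  let j' : ℕ → Fin (N + 1) := fun x => ⟨min (j x) N, Nat.lt_succ_of_le (min_le_right _ _)⟩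
  have hj' : ∀ x ∈ φ.vars, (j' x : ℕ) = j x := fun x hx =>
    min_eq_left (hN (Set.mem_insert_of_mem _ (Set.mem_image_of_mem j hx)))
  have hb := h (N + 1) ⟨i, Nat.lt_succ_of_le hi⟩ φ hφ j' (fun x => le_min (hj x) hi)
    ((φ.realize_congr fun x hx => by simp only [hj' x hx]).2 ha)
  refine (Atom.realize_congr _ fun x hx => ?_).1 hb
  rw [V.vars_appr φ _ (he i)] at hx
  simp only [hj' x hx]

end ApproxPreserves

end ApproxPreserves

section BiTotalOn

/-- The relation `R` relates every element of `S` to an element of `T` and conversely. -/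
def BiTotalOn {M N : Type*} (S : Set M) (T : Set N) (R : M → N → Prop) : Prop :=
  (∀ a ∈ S, ∃ b ∈ T, R a b) ∧ ∀ b ∈ T, ∃ a ∈ S, R a b

namespace BiTotalOn

variable {M N O : Type*} {S : Set M} {T : Set N} {U : Set O} {R R' : M → N → Prop}

theorem mono (h : BiTotalOn S T R) (hR : ∀ a ∈ S, ∀ b ∈ T, R a b → R' a b) : BiTotalOn S T R' :=
  ⟨fun a ha => (h.1 a ha).imp fun b hb => ⟨hb.1, hR a ha b hb.1 hb.2⟩,
    fun b hb => (h.2 b hb).imp fun a ha => ⟨ha.1, hR a ha.1 b hb ha.2⟩⟩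

theorem swap (h : BiTotalOn S T R) : BiTotalOn T S fun b a => R a b :=
  ⟨h.2, h.1⟩

theorem comp {R' : N → O → Prop} (h : BiTotalOn S T R) (h' : BiTotalOn T U R') :
    BiTotalOn S U fun a c => ∃ b ∈ T, R a b ∧ R' b c := by
  refine ⟨fun a ha => ?_, fun c hc => ?_⟩
  · obtain ⟨b, hb, hab⟩ := h.1 a ha
    obtain ⟨c, hc, hbc⟩ := h'.1 b hb
    exact ⟨c, hc, b, hb, hab, hbc⟩
  · obtain ⟨b, hb, hbc⟩ := h'.2 c hc
    obtain ⟨a, ha, hab⟩ := h.2 b hb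
    exact ⟨a, ha, b, hb, hab, hbc⟩

end BiTotalOn

theorem biTotalOn_iff_forall_answers {M N : Type u} {S : Set M} {T : Set N} {R : M → N → Prop} :
    BiTotalOn S T R ↔ ∀ x : M ⊕ N, Sum.elim (· ∈ S) (· ∈ T) x →
      ∃ y : M × N, (Answers x y ∧ y.1 ∈ S ∧ y.2 ∈ T) ∧ R y.1 y.2 := by
  refine ⟨fun h x hx => ?_, fun h => ⟨fun a ha => ?_, fun b hb => ?_⟩⟩
  · rcases x with a | b
    · obtain ⟨b, hb, hab⟩ := h.1 a hx
      exact ⟨(a, b), ⟨Or.inl rfl, hx, hb⟩, hab⟩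
    · obtain ⟨a, ha, hab⟩ := h.2 b hx
      exact ⟨(a, b), ⟨Or.inr rfl, ha, hx⟩, hab⟩
  · obtain ⟨⟨a', b⟩, ⟨hy, -, hb⟩, hab⟩ := h (.inl a) ha
    obtain rfl : a = a' := by simpa [Answers] using hy
    exact ⟨b, hb, hab⟩
  · obtain ⟨⟨a, b'⟩, ⟨hy, ha, -⟩, hab⟩ := h (.inr b) hb
    obtain rfl : b = b' := by simpa [Answers] using hy
    exact ⟨a, ha, hab⟩

end BiTotalOn

section Positions

variable {M N : Type u} {n : ℕ}

/-- The position of the dynamic game given by tuples `ā`, `b̄`, `ε̄`, `k̄` of length `n`. -/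
def tuplePosition (a : Fin n → M) (b : Fin n → N) (e : Fin n → ℝ) (k : Fin n → ℕ) :
    List (Mark (M × N)) :=
  List.ofFn fun i => ⟨(a i, b i), e i, k i⟩

theorem tuplePosition_snoc (a : Fin n → M) (b : Fin n → N) (e : Fin n → ℝ) (k : Fin n → ℕ)
    (x : M) (y : N) (d : ℝ) (l : ℕ) :
    tuplePosition (Fin.snoc a x : Fin (n + 1) → M) (Fin.snoc b y : Fin (n + 1) → N)
      (Fin.snoc e d : Fin (n + 1) → ℝ) (Fin.snoc k l : Fin (n + 1) → ℕ) =
      tuplePosition a b e k ++ [⟨(x, y), d, l⟩] := by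
  rw [tuplePosition, List.ofFn_succ', List.concat_eq_append]
  simp [tuplePosition]

theorem exists_eq_tuplePosition (P : List (Mark (M × N))) :
    ∃ (n : ℕ) (a : Fin n → M) (b : Fin n → N) (e : Fin n → ℝ) (k : Fin n → ℕ),
      P = tuplePosition a b e k :=
  ⟨P.length, fun i => P[i].pt.1, fun i => P[i].pt.2, fun i => P[i].eps, fun i => P[i].lvl,
    List.ofFn_getElem.symm⟩

variable {L : FirstOrder.Language.{u, u}} {K : Set (Bundled.{u} L.Structure)}
  {V : Approximations L K} {G : GoodSets V} {A B : K}

theorem preserves_iff_approxPreserves {P : List (Mark (A.1 × B.1))} :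
    Preserves G P ↔ ApproxPreserves G (fun i => (P.get i).pt.1) (fun i => (P.get i).pt.2)
      (fun i => (P.get i).eps) fun i => (P.get i).lvl :=
  Iff.rfl

theorem preserves_tuplePosition {a : Fin n → A.1} {b : Fin n → B.1} {e : Fin n → ℝ}
    {k : Fin n → ℕ} : Preserves G (tuplePosition a b e k) ↔ ApproxPreserves G a b e k := by
  have hn : (tuplePosition a b e k).length = n := List.length_ofFn
  have hget : ∀ i, (tuplePosition a b e k).get i =
      ⟨(a (i.cast hn), b (i.cast hn)), e (i.cast hn), k (i.cast hn)⟩ := List.get_ofFn _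
  simp only [preserves_iff_approxPreserves, hget]
  exact ⟨fun h => h.comp (Fin.cast hn.symm) (Fin.cast hn.symm) fun _ _ => id,
    fun h => h.comp (Fin.cast hn) (Fin.cast hn) fun _ _ => id⟩

theorem Preserves.of_append {P R : List (Mark (A.1 × B.1))} (h : Preserves G (P ++ R)) :
    Preserves G P := by
  have hl : P.length ≤ (P ++ R).length := by simp
  simpa [preserves_iff_approxPreserves] using
    (preserves_iff_approxPreserves.1 h).comp (Fin.castLE hl) (Fin.castLE hl) fun _ _ => id

end Positions

section Survives

variable {L : FirstOrder.Language.{u, u}} {K : Set (Bundled.{u} L.Structure)}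
  {V : Approximations L K} (G : GoodSets V) {A B : K}

/-- Player `II` can hold out in the dynamic game with clock `α` from the position `P`. -/
def Survives (ε : ℝ) (S : Set A.1) (T : Set B.1) (α : Ordinal.{u})
    (P : List (Mark (A.1 × B.1))) : Prop :=
  Preserves G P ∧ ∀ β, β < α → ∀ e ∈ V.D, ε < e → ∀ k : ℕ,
    BiTotalOn S T fun a b => Survives ε S T β (P ++ [⟨(a, b), e, k⟩])
termination_by α

variable {G} {ε : ℝ} {S : Set A.1} {T : Set B.1} {P : List (Mark (A.1 × B.1))} {α β : Ordinal.{u}}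

theorem survives_iff : Survives G ε S T α P ↔
    Preserves G P ∧ ∀ β, β < α → ∀ e ∈ V.D, ε < e → ∀ k : ℕ,
      BiTotalOn S T fun a b => Survives G ε S T β (P ++ [⟨(a, b), e, k⟩]) := by
  rw [Survives]

namespace Survives

theorem preserves (h : Survives G ε S T α P) : Preserves G P :=
  (survives_iff.1 h).1

theorem biTotalOn (h : Survives G ε S T α P) (hβ : β < α) {e : ℝ} (he : e ∈ V.D) (hε : ε < e)
    (k : ℕ) : BiTotalOn S T fun a b => Survives G ε S T β (P ++ [⟨(a, b), e, k⟩]) :=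
  (survives_iff.1 h).2 β hβ e he hε k

theorem mono (h : Survives G ε S T α P) (hβ : β ≤ α) : Survives G ε S T β P :=
  survives_iff.2 ⟨h.preserves, fun _ hγ _ he hε k => h.biTotalOn (hγ.trans_le hβ) he hε k⟩

end Survives

theorem survives_zero : Survives G ε S T 0 P ↔ Preserves G P :=
  ⟨Survives.preserves, fun h => survives_iff.2 ⟨h, fun _ hβ => absurd hβ not_lt_zero⟩⟩

theorem survives_add_one (hS : S.Nonempty) :
    Survives G ε S T (β + 1) P ↔ ∀ e ∈ V.D, ε < e → ∀ k : ℕ,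
      BiTotalOn S T fun a b => Survives G ε S T β (P ++ [⟨(a, b), e, k⟩]) := by
  refine ⟨fun h e he hε k => h.biTotalOn (lt_add_one β) he hε k, fun h => survives_iff.2
    ⟨?_, fun γ hγ e he hε k => (h e he hε k).mono fun a _ b _ hab =>
      hab.mono (Order.lt_add_one_iff.1 hγ)⟩⟩
  obtain ⟨a, ha⟩ := hS
  obtain ⟨e, he, hε⟩ := V.exists_mem_gt ε
  obtain ⟨b, -, hb⟩ := (h e he hε 0).1 a ha
  exact hb.preserves.of_append

theorem survives_limit (hα : Order.IsSuccLimit α) :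
    Survives G ε S T α P ↔ ∀ β < α, Survives G ε S T β P :=
  ⟨fun h β hβ => h.mono hβ.le, fun h => survives_iff.2 ⟨(h 0 hα.bot_lt).preserves,
    fun β hβ _ he hε k =>
      (h (β + 1) (by simpa using hα.succ_lt hβ)).biTotalOn (lt_add_one β) he hε k⟩⟩

end Survives

namespace Game

variable {X Y : Type*} {G : Game X Y}

theorem forall_rounds_concat {C : List (X × Y) → X × Y → Prop} {h : List (X × Y)} {r : X × Y} :
    (∀ (i : ℕ) (hi : i < (h ++ [r]).length), C ((h ++ [r]).take i) (h ++ [r])[i]) ↔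
      (∀ (i : ℕ) (hi : i < h.length), C (h.take i) h[i]) ∧ C h r := by
  refine ⟨fun H => ⟨fun i hi => ?_, by simpa using H h.length (by simp)⟩, fun H i hi => ?_⟩
  · have hround := H i (by simp only [List.length_append]; omega)
    rwa [List.take_append_of_le_length hi.le, List.getElem_append_left hi] at hround
  · rcases (show i ≤ h.length by simpa [Nat.lt_succ_iff] using hi).lt_or_eq with hlt | rfl
    · rw [List.take_append_of_le_length hlt.le, List.getElem_append_left hlt]
      exact H.1 i hlt
    · simpa using H.2

theorem isPlay_nil : G.IsPlay [] := fun _ hi => absurd hi (Nat.not_lt_zero _)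

theorem isPlay_concat {h : List (X × Y)} {r : X × Y} : G.IsPlay (h ++ [r]) ↔
    G.IsPlay h ∧ ¬ G.ended h ∧ G.legalI h r.1 ∧ G.legalII h r.1 r.2 :=
  forall_rounds_concat (C := fun h r => ¬ G.ended h ∧ G.legalI h r.1 ∧ G.legalII h r.1 r.2)

theorem followsI_nil (ρ : List (X × Y) → X) : FollowsI ρ [] :=
  fun _ hi => absurd hi (Nat.not_lt_zero _)

theorem followsI_concat {ρ : List (X × Y) → X} {h : List (X × Y)} {r : X × Y} :
    FollowsI ρ (h ++ [r]) ↔ FollowsI ρ h ∧ r.1 = ρ h :=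
  forall_rounds_concat (C := fun h r => r.1 = ρ h)

theorem followsII_nil (τ : List (X × Y) → X → Y) : FollowsII τ [] :=
  fun _ hi => absurd hi (Nat.not_lt_zero _)

theorem followsII_concat {τ : List (X × Y) → X → Y} {h : List (X × Y)} {r : X × Y} :
    FollowsII τ (h ++ [r]) ↔ FollowsII τ h ∧ r.2 = τ h r.1 :=
  forall_rounds_concat (C := fun h r => r.2 = τ h r.1)

theorem firstRounds_succ (p : ℕ → X × Y) (n : ℕ) :
    firstRounds p (n + 1) = firstRounds p n ++ [p n] := by
  rw [firstRounds, List.ofFn_succ', List.concat_eq_append]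
  rfl

theorem IWins.of_invariant [Nonempty X] (J : List (X × Y) → Prop) (h0 : J [])
    (hstep : ∀ h, J h → ¬ G.ended h →
      ∃ x, G.legalI h x ∧ ∀ y, G.legalII h x y → J (h ++ [(x, y)]))
    (hfin : ∀ h, J h → G.ended h → ¬ G.winsFin h)
    (hinf : ∀ p, (∀ n, G.IsPlay (firstRounds p n)) → ¬ G.winsInf p) : G.IWins := by
  choose! ρ hlegal hinv using hstep
  have hJ : ∀ h, G.IsPlay h → FollowsI ρ h → J h := fun h => by
    induction h using List.reverseRecOn with
    | nil => exact fun _ _ => h0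
    | append_singleton h r ih =>
      obtain ⟨x, y⟩ := r
      intro hplay hfollows
      obtain ⟨hplay', hend, -, hy⟩ := isPlay_concat.1 hplay
      obtain ⟨hfollows', hx : x = ρ h⟩ := followsI_concat.1 hfollows
      subst hx
      exact hinv h (ih hplay' hfollows') hend y hy
  exact ⟨ρ, fun h hplay hfollows => hlegal h (hJ h hplay hfollows),
    fun h hplay hfollows => hfin h (hJ h hplay hfollows), fun p hp => hinf p fun n => (hp n).1⟩

theorem IIWins.of_invariant [Nonempty Y] (J : List (X × Y) → Prop) (h0 : J [])
    (hstep : ∀ h x, J h → ¬ G.ended h → G.legalI h x → ∃ y, G.legalII h x y ∧ J (h ++ [(x, y)]))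
    (hfin : ∀ h, J h → G.ended h → G.winsFin h)
    (hinf : ∀ p, (∀ n, J (firstRounds p n)) → G.winsInf p) : G.IIWins := by
  choose! τ hlegal hinv using hstep
  have hJ : ∀ h, G.IsPlay h → FollowsII τ h → J h := fun h => by
    induction h using List.reverseRecOn with
    | nil => exact fun _ _ => h0
    | append_singleton h r ih =>
      obtain ⟨x, y⟩ := r
      intro hplay hfollows
      obtain ⟨hplay', hend, hx, -⟩ := isPlay_concat.1 hplay
      obtain ⟨hfollows', hy : y = τ h x⟩ := followsII_concat.1 hfollows
      subst hy
      exact hinv h x (ih hplay' hfollows') hend hx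
  exact ⟨τ, fun h x hplay hfollows => hlegal h x (hJ h hplay hfollows),
    fun h hplay hfollows => hfin h (hJ h hplay hfollows),
    fun p hp => hinf p fun n => hJ _ (hp n).1 (hp n).2⟩

section Continuation

variable (τ : List (X × Y) → X → Y) (f : ℕ → X) (h : List (X × Y))

/-- The infinite play that extends `h`, in which from then on `I` plays `f n` in round `n` and `II`
follows the strategy `τ`. -/
def continuation (n : ℕ) : X × Y :=
  if hn : n < h.length then h[n]
  else (f n, τ (List.ofFn fun i : Fin n => continuation i) (f n))
termination_by n
decreasing_by exact i.2

theorem continuation_of_length_le {n : ℕ} (hn : h.length ≤ n) : continuation τ f h n =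
    (f n, τ (firstRounds (continuation τ f h) n) (f n)) := by
  rw [continuation, dif_neg hn.not_gt, firstRounds]

theorem firstRounds_continuation : firstRounds (continuation τ f h) h.length = h := by
  refine List.ext_getElem (by simp [firstRounds]) fun i _ hi => ?_
  simp only [firstRounds, List.getElem_ofFn]
  rw [continuation, dif_pos hi]

variable {τ f h}

theorem isPlay_and_followsII_continuation (hend : ∀ h, ¬ G.ended h)
    (hτ : ∀ h x, G.IsPlay h → FollowsII τ h → ¬ G.ended h → G.legalI h x → G.legalII h x (τ h x))
    (hf : ∀ h n, G.legalI h (f n)) (hplay : G.IsPlay h) (hfollows : FollowsII τ h) (n : ℕ) :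
    G.IsPlay (firstRounds (continuation τ f h) n) ∧
      FollowsII τ (firstRounds (continuation τ f h) n) := by
  set p := continuation τ f h with hp
  have hanti : Antitone fun n => G.IsPlay (firstRounds p n) ∧ FollowsII τ (firstRounds p n) :=
    antitone_nat_of_succ_le fun n hn => by
      rw [firstRounds_succ, isPlay_concat, followsII_concat] at hn
      exact ⟨hn.1.1, hn.2.1⟩
  have hlarge : ∀ n, h.length ≤ n →
      G.IsPlay (firstRounds p n) ∧ FollowsII τ (firstRounds p n) := fun n hn => by
    induction n, hn using Nat.le_induction with
    | base => rw [hp, firstRounds_continuation]; exact ⟨hplay, hfollows⟩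
    | succ n hn ih =>
      rw [firstRounds_succ, isPlay_concat, followsII_concat, hp,
        continuation_of_length_le τ f h hn, ← hp]
      exact ⟨⟨ih.1, hend _, hf _ _, hτ _ _ ih.1 ih.2 (hend _) (hf _ _)⟩, ih.2, rfl⟩
  exact hanti (le_max_left n h.length) (hlarge _ (le_max_right n h.length))

end Continuation

end Game

section DynamicGame

variable {L : FirstOrder.Language.{u, u}} {K : Set (Bundled.{u} L.Structure)}
  {V : Approximations L K} {G : GoodSets V} {A B : K} {ε : ℝ} {S : Set A.1} {T : Set B.1}
  {P : List (Mark (A.1 × B.1))} {α β : Ordinal.{u}}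

/-- The time left on a clock started at `α` after the rounds `h`: the minimum of `α` and of the
ordinals that `I` has played. -/
def remaining {M N Y : Type u} (α : Ordinal.{u}) (h : List (DynMove M N × Y)) : Ordinal.{u} :=
  h.foldl (fun o q => min o q.1.clock) α

theorem remaining_concat {M N Y : Type u} (α : Ordinal.{u}) (h : List (DynMove M N × Y))
    (r : DynMove M N × Y) : remaining α (h ++ [r]) = min (remaining α h) r.1.clock := by
  simp [remaining]

theorem lt_remaining_iff {M N Y : Type u} {α o : Ordinal.{u}} {h : List (DynMove M N × Y)} :
    o < remaining α h ↔ o < α ∧ ∀ q ∈ h, o < q.1.clock := by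
  induction h using List.reverseRecOn with
  | nil => simp [remaining]
  | append_singleton h r ih =>
    rw [remaining_concat, lt_min_iff, ih]
    simp only [List.mem_append, List.mem_singleton, or_imp, forall_and, forall_eq, and_assoc]

theorem remaining_eq_zero_iff {M N Y : Type u} {α : Ordinal.{u}} {h : List (DynMove M N × Y)} :
    remaining α h = 0 ↔ α = 0 ∨ ∃ q ∈ h, q.1.clock = 0 := by
  rw [← not_iff_not, ← ne_eq, ← pos_iff_ne_zero, lt_remaining_iff]
  simp only [pos_iff_ne_zero, not_or, not_exists, not_and, ne_eq]

/-- The position of the dynamic game started at `P` after the rounds `h`. -/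
def positionAfter {M N : Type u} (P : List (Mark (M × N))) (h : List (DynMove M N × (M × N))) :
    List (Mark (M × N)) :=
  P ++ h.map fun q => ⟨q.2, q.1.eps, q.1.lvl⟩

theorem positionAfter_concat {M N : Type u} (P : List (Mark (M × N)))
    (h : List (DynMove M N × (M × N))) (r : DynMove M N × (M × N)) :
    positionAfter P (h ++ [r]) = positionAfter P h ++ [⟨r.2, r.1.eps, r.1.lvl⟩] := by
  simp [positionAfter]

theorem not_iWins_of_survives (h : Survives G ε S T α P) : ¬ (dynGame G α ε S T P).IWins := by
  rintro ⟨ρ, hlegal, hfin, -⟩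
  have hlost : ∀ β : Ordinal.{u}, ∀ h, (dynGame G α ε S T P).IsPlay h → Game.FollowsI ρ h →
      remaining α h = β → ¬ Survives G ε S T β (positionAfter P h) := fun β => by
    induction β using WellFoundedLT.induction with
    | ind β ih =>
      intro h hplay hfollows hβ hs
      by_cases hend : (dynGame G α ε S T P).ended h
      · exact hfin h hplay hfollows hend hs.preserves
      have hmove := hlegal h hplay hfollows hend
      obtain ⟨hpt, hD, hε, hclock⟩ := hmove
      have hlt : (ρ h).clock < β := hβ ▸ lt_remaining_iff.2 hclock
      obtain ⟨y, hy, hs'⟩ :=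
        biTotalOn_iff_forall_answers.1 (hs.biTotalOn hlt hD hε (ρ h).lvl) (ρ h).pt hpt
      exact ih _ hlt (h ++ [(ρ h, y)])
        (Game.isPlay_concat.2 ⟨hplay, hend, ⟨hpt, hD, hε, hclock⟩, hy⟩)
        (Game.followsI_concat.2 ⟨hfollows, rfl⟩) (by rw [remaining_concat, hβ, min_eq_right hlt.le])
        (by rw [positionAfter_concat]; exact hs')
  exact hlost α [] Game.isPlay_nil (Game.followsI_nil _) rfl (by simpa [positionAfter] using h)

theorem exists_move_of_not_survives (hα : 0 < α) (hS : S.Nonempty) (h : ¬ Survives G ε S T α P) :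
    ∃ x : DynMove A.1 B.1, (Sum.elim (· ∈ S) (· ∈ T) x.pt ∧ x.eps ∈ V.D ∧ ε < x.eps ∧
      x.clock < α) ∧ ∀ y : A.1 × B.1, Answers x.pt y ∧ y.1 ∈ S ∧ y.2 ∈ T →
        ¬ Survives G ε S T x.clock (P ++ [⟨y, x.eps, x.lvl⟩]) := by
  by_cases hP : Preserves G P
  · rw [survives_iff] at h
    simp only [hP, true_and, biTotalOn_iff_forall_answers] at h
    push Not at h
    obtain ⟨β, hβ, e, he, hε, k, x, hx, hy⟩ := h
    exact ⟨⟨x, e, k, β⟩, ⟨hx, he, hε, hβ⟩, hy⟩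
  · obtain ⟨a, ha⟩ := hS
    obtain ⟨e, he, hε⟩ := V.exists_mem_gt ε
    exact ⟨⟨Sum.inl a, e, 0, 0⟩, ⟨ha, he, hε, hα⟩, fun _ _ hs => hP hs.preserves.of_append⟩

theorem iWins_of_not_survives (hS : S.Nonempty) (h : ¬ Survives G ε S T α P) :
    (dynGame G α ε S T P).IWins := by
  have : Nonempty (DynMove A.1 B.1) := ⟨⟨Sum.inl hS.some, 0, 0, 0⟩⟩
  refine Game.IWins.of_invariant
    (fun h => ¬ Survives G ε S T (remaining α h) (positionAfter P h)) ?_ ?_ ?_ ?_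
  · simpa [positionAfter, remaining] using h
  · intro h hJ hend
    have hpos : 0 < remaining α h :=
      pos_iff_ne_zero.2 fun h0 => hend (remaining_eq_zero_iff.1 h0)
    obtain ⟨x, ⟨hx, hD, hε, hα⟩, hy⟩ := exists_move_of_not_survives hpos hS hJ
    refine ⟨x, ⟨hx, hD, hε, lt_remaining_iff.1 hα⟩, fun y hl => ?_⟩
    rw [remaining_concat, min_eq_right hα.le, positionAfter_concat]
    exact hy y hl
  · intro h hJ hend hwins
    rw [remaining_eq_zero_iff.2 hend] at hJ
    exact hJ (survives_zero.2 hwins)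
  · intro p hp _
    have hdec : ∀ n, (p (n + 1)).1.clock < (p n).1.clock := fun n => by
      have hplay := hp (n + 1 + 1)
      rw [Game.firstRounds_succ, Game.isPlay_concat] at hplay
      exact hplay.2.2.1.2.2.2.2 (p n) (by simp [Game.firstRounds_succ])
    exact (RelEmbedding.natGT (r := (· < ·)) (fun n => (p n).1.clock) hdec).not_wellFounded
      wellFounded_lt

theorem iWins_dynGame_iff (hS : S.Nonempty) :
    (dynGame G α ε S T P).IWins ↔ ¬ Survives G ε S T α P :=
  ⟨fun hI hs => not_iWins_of_survives hs hI, iWins_of_not_survives hS⟩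

theorem Survives.of_watershed_le (hS : S.Nonempty) (h : Survives G ε S T α P)
    (hα : watershed G ε S T P ≤ α) : Survives G ε S T β P := by
  by_contra hβ
  have hmem : watershed G ε S T P ∈ {γ | (dynGame G γ ε S T P).IWins} :=
    csInf_mem ⟨β, (iWins_dynGame_iff hS).2 hβ⟩
  exact (iWins_dynGame_iff hS).1 hmem (h.mono hα)

theorem watershed_le_innerScottRank {Q : Set ℝ} {S : Set A.1} {n : ℕ} {a b : Fin n → A.1}
    {e : Fin n → ℝ} (k : Fin n → ℕ) (hε : ε ∈ V.D) (h0 : 0 < ε) (ha : ∀ i, a i ∈ S)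
    (hb : ∀ i, b i ∈ S) (he : ∀ i, e i ∈ Q ∧ ε < e i) :
    watershed G (A := A) (B := A) ε S S (tuplePosition a b e k) ≤ innerScottRank G Q S :=
  le_ciSup_of_le Ordinal.bddAbove_of_small ⟨ε, hε, h0⟩ <|
    le_ciSup_of_le Ordinal.bddAbove_of_small n <|
    le_ciSup_of_le Ordinal.bddAbove_of_small (fun i => ⟨e i, he i⟩) <|
    le_ciSup_of_le Ordinal.bddAbove_of_small k <|
    le_ciSup_of_le Ordinal.bddAbove_of_small (fun i => ⟨a i, ha i⟩) <|
    le_ciSup_of_le Ordinal.bddAbove_of_small (fun i => ⟨b i, hb i⟩) le_rfl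

end DynamicGame

section ScottSentence

variable {L : FirstOrder.Language.{u, u}} {K : Set (Bundled.{u} L.Structure)}
  {V : Approximations L K} {G : GoodSets V} {A B : K} {ε : ℝ} {S : Set A.1}

theorem gameFormula_zero (P : List (Mark A.1)) : gameFormula G ε S 0 P = .conj
      {q : Fin P.length × Atom L × (ℕ → Fin P.length) //
        q.2.1 ∈ G.Good (P.get q.1).lvl ∧ (∀ x, q.1 ≤ q.2.2 x) ∧
          q.2.1.Realize fun x => (P.get (q.2.2 x)).pt}
      fun q => .atom ((V.appr q.1.2.1 (P.get q.1.1).eps).rename fun x => (q.1.2.2 x : ℕ)) := by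
  rw [gameFormula, Ordinal.limitRecOn_zero]

theorem gameFormula_add_one (α : Ordinal.{u}) (P : List (Mark A.1)) :
    gameFormula G ε S (α + 1) P =
      .conjSmall fun e : {e : ℝ // e ∈ V.D ∧ ε < e} => .conjSmall fun k : ℕ =>
      (Formula.conj S fun a => .ex P.length (gameFormula G ε S α (P ++ [⟨a.1, e.1, k⟩]))).and
        (.all P.length (.disj S fun a => gameFormula G ε S α (P ++ [⟨a.1, e.1, k⟩]))) := by
  rw [gameFormula, Ordinal.limitRecOn_add_one]
  rfl

theorem gameFormula_limit {α : Ordinal.{u}} (hα : Order.IsSuccLimit α) (P : List (Mark A.1)) :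
    gameFormula G ε S α P = .conj α.ToType fun β => gameFormula G ε S β.toOrd.1 P := by
  rw [gameFormula, Ordinal.limitRecOn_limit _ _ _ _ hα]
  rfl

/-- The position of the dynamic game in which the values of the variables `v₀, v₁, …` have been
chosen opposite to the points of the tuple `P`. -/
def pairing {M N : Type u} (P : List (Mark M)) (v : ℕ → N) : List (Mark (M × N)) :=
  P.mapIdx fun i m => ⟨(m.pt, v i), m.eps, m.lvl⟩

theorem pairing_eq_tuplePosition {M N : Type u} (P : List (Mark M)) (v : ℕ → N) :
    pairing P v = tuplePosition (fun i => (P.get i).pt) (fun i : Fin P.length => v i)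
      (fun i => (P.get i).eps) fun i => (P.get i).lvl :=
  List.mapIdx_eq_ofFn _ _

theorem pairing_ofFn {M N : Type u} {n : ℕ} (a : Fin n → M) (e : Fin n → ℝ) (k : Fin n → ℕ)
    (v : ℕ → N) : pairing (List.ofFn fun i => ⟨a i, e i, k i⟩) v =
      tuplePosition a (fun i => v i) e k :=
  List.ext_getElem (by simp [pairing, tuplePosition]) fun i _ _ => by
    simp [pairing, tuplePosition]

theorem pairing_update {M N : Type u} (P : List (Mark M)) (v : ℕ → N) (m : Mark M) (y : N) :
    pairing (P ++ [m]) (Function.update v P.length y) =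
      pairing P v ++ [⟨(m.pt, y), m.eps, m.lvl⟩] := by
  have hP : pairing P (Function.update v P.length y) = pairing P v :=
    List.ext_getElem (by simp [pairing]) fun i _ hi => by
      have hne : i ≠ P.length := by simp only [pairing, List.length_mapIdx] at hi; omega
      simp [pairing, hne]
  rw [← hP, pairing, List.mapIdx_concat]
  simp [pairing]

theorem realize_gameFormula (hS : S.Nonempty) (α : Ordinal.{u}) (P : List (Mark A.1))
    (v : ℕ → B.1) : (gameFormula G ε S α P).Realize v ↔
      Survives G ε S Set.univ α (pairing P v) := by
  induction α using Ordinal.limitRecOn generalizing P v with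
  | zero =>
    rw [gameFormula_zero, survives_zero, pairing_eq_tuplePosition, preserves_tuplePosition]
    simp only [Formula.Realize, Atom.realize_rename, Subtype.forall, Prod.forall]
    exact ⟨fun h i φ hφ j hj ha => h i φ j ⟨hφ, hj, ha⟩,
      fun h i φ j hφ => h i φ hφ.1 j hφ.2.1 hφ.2.2⟩
  | add_one α ih =>
    rw [gameFormula_add_one, survives_add_one hS]
    simp only [Formula.realize_conjSmall, Formula.realize_and, Formula.Realize, ih,
      pairing_update, Subtype.forall, Subtype.exists, BiTotalOn, Set.mem_univ, true_and,
      forall_const, exists_prop, and_imp]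
  | limit α hα ih =>
    rw [gameFormula_limit hα, survives_limit hα]
    simp only [Formula.Realize]
    refine ⟨fun h β hβ => ?_, fun h β => (ih _ β.toOrd.2 _ _).2 (h _ β.toOrd.2)⟩
    simpa using (ih _ (Ordinal.ToType.toOrd _).2 _ _).1 (h (Ordinal.ToType.mk ⟨β, hβ⟩))

variable (G S B) in
/-- The content of the implications in the Scott sentence: relaxing the precisions of a position
from which `II` can hold out for the time `ρ` gains her one more round. -/
def Stabilizes (ρ : Ordinal.{u}) : Prop :=
  ∀ ε ∈ V.D, 0 < ε → ∀ ε' ∈ V.D, ε < ε' → ∀ (n : ℕ) (a : Fin n → A.1) (b : Fin n → B.1)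
    (e e' : Fin n → ℝ) (k : Fin n → ℕ), (∀ i, a i ∈ S) → (∀ i, e i ∈ V.D ∧ ε < e i) →
    (∀ i, e' i ∈ V.D ∧ ε' < e' i ∧ e i < e' i) →
    Survives G ε S Set.univ ρ (tuplePosition a b e k) →
      Survives G ε' S Set.univ (ρ + 1) (tuplePosition a b e' k)

theorem models_gameFormula_nil (hS : S.Nonempty) (α : Ordinal.{u}) :
    Formula.Models B.1 (gameFormula G ε S α []) ↔
      Survives G ε S (Set.univ : Set B.1) α [] := by
  have := V.nonempty B
  exact ⟨fun h => (realize_gameFormula hS α [] _).1 (h fun _ => Classical.arbitrary B.1),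
    fun h v => (realize_gameFormula hS α [] v).2 h⟩

theorem models_allFirst_imp_gameFormula (hS : S.Nonempty) {ε' : ℝ} {α β : Ordinal.{u}} {n : ℕ}
    (a : Fin n → A.1) (e e' : Fin n → ℝ) (k : Fin n → ℕ) :
    Formula.Models B.1 (.allFirst n <| V.imp
        (gameFormula G ε S α (List.ofFn fun i => ⟨a i, e i, k i⟩))
        (gameFormula G ε' S β (List.ofFn fun i => ⟨a i, e' i, k i⟩))) ↔
      ∀ b : Fin n → B.1, Survives G ε S Set.univ α (tuplePosition a b e k) →
        Survives G ε' S Set.univ β (tuplePosition a b e' k) := by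
  rw [Formula.models_allFirst]
  simp only [Formula.Models, V.realize_imp, realize_gameFormula hS, pairing_ofFn]
  refine ⟨fun h b => ?_, fun h v => h fun i => v i⟩
  have := V.nonempty B
  obtain ⟨v, hv⟩ : ∃ v : ℕ → B.1, (fun i : Fin n => v i) = b :=
    ⟨fun x => if hx : x < n then b ⟨x, hx⟩ else Classical.arbitrary B.1, by simp⟩
  exact hv ▸ h v

theorem models_scottSentence_iff (hS : S.Nonempty) (Q : Set ℝ) :
    Formula.Models B.1 (scottSentence G Q S) ↔
      (∀ ε ∈ V.D, 0 < ε →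
        Survives G ε S (Set.univ : Set B.1) (innerScottRank G Q S) []) ∧
      Stabilizes G B S (innerScottRank G Q S) := by
  simp only [scottSentence, Formula.models_conjSmall, Formula.models_and, Formula.models_conj,
    models_gameFormula_nil hS, models_allFirst_imp_gameFormula hS]
  refine ⟨fun h => ⟨fun ε hε h0 => (h ⟨ε, hε, h0⟩).1, fun ε hε h0 ε' hε' hlt n a b e e' k ha he
    he' => (h ⟨ε, hε, h0⟩).2 n (fun i => ⟨e i, he i⟩) k ⟨ε', hε', hlt⟩ (fun i => ⟨e' i, he' i⟩)
      (fun i => ⟨a i, ha i⟩) b⟩, ?_⟩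
  rintro ⟨hnil, hstab⟩ ⟨ε, hε, h0⟩
  exact ⟨hnil ε hε h0, fun n e k ε' e' a b => hstab ε hε h0 ε' ε'.2.1 ε'.2.2 n (fun i => a i) b _
    _ k (fun i => (a i).2) (fun i => (e i).2) fun i => (e' i).2⟩

end ScottSentence

section BackForth

variable {L : FirstOrder.Language.{u, u}} {K : Set (Bundled.{u} L.Structure)}
  {V : Approximations L K} (G : GoodSets V) {A B C : K}

/-- A back-and-forth system of precision `η` between `S ⊆ A` and `T ⊆ B`: a set of positions in
which `II` can stay in the dynamic game without a clock. -/
structure IsBackForth (η : ℝ) (S : Set A.1) (T : Set B.1) (F : Set (List (Mark (A.1 × B.1)))) :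
    Prop where
  nil_mem : [] ∈ F
  preserves : ∀ P ∈ F, Preserves G P
  extend : ∀ P ∈ F, ∀ e ∈ V.D, η < e → ∀ k : ℕ,
    BiTotalOn S T fun a b => P ++ [⟨(a, b), e, k⟩] ∈ F

/-- The mark with the roles of the structures exchanged, with precision `ξ`. The level is raised to
cover the weak negations of the approximations of the formulas of the old level. -/
def Mark.flip {M N : Type u} (ξ : ℝ) (m : Mark (M × N)) : Mark (N × M) :=
  ⟨m.pt.swap, ξ, ⌈(m.lvl : ℝ) * Real.exp m.eps⌉₊⟩

theorem map_flip_tuplePosition {M N : Type u} {n : ℕ} (ξ : ℝ) (a : Fin n → M) (b : Fin n → N)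
    (e : Fin n → ℝ) (k : Fin n → ℕ) : (tuplePosition a b e k).map (Mark.flip ξ) =
      tuplePosition b a (fun _ => ξ) fun i => ⌈(k i : ℝ) * Real.exp (e i)⌉₊ := by
  simp [tuplePosition, Mark.flip, List.map_ofFn, Function.comp_def]

variable {G} {η ξ ε ε' : ℝ} {S : Set A.1} {T : Set B.1} {U : Set C.1}
  {F : Set (List (Mark (A.1 × B.1)))} {α β : Ordinal.{u}} {n : ℕ}

namespace IsBackForth

theorem survives (hF : IsBackForth G η S T F) {P : List (Mark (A.1 × B.1))} (hP : P ∈ F)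
    (α : Ordinal.{u}) : Survives G η S T α P := by
  induction α using WellFoundedLT.induction generalizing P with
  | ind α ih => exact survives_iff.2 ⟨hF.preserves P hP, fun β hβ e he hη k =>
      (hF.extend P hP e he hη k).mono fun _ _ _ _ hab => ih β hβ hab⟩

theorem exists_extension (hF : IsBackForth G η S T F) {n : ℕ} {a : Fin n → A.1} {e : Fin n → ℝ}
    (k : Fin n → ℕ) (ha : ∀ i, a i ∈ S) (he : ∀ i, e i ∈ V.D ∧ η < e i) :
    ∃ b : Fin n → B.1, (∀ i, b i ∈ T) ∧ tuplePosition a b e k ∈ F := by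
  induction n with
  | zero => exact ⟨Fin.elim0, fun i => i.elim0, by simpa [tuplePosition] using hF.nil_mem⟩
  | succ n ih =>
    obtain ⟨b, hb, hbF⟩ := ih (Fin.init k) (fun i => ha i.castSucc) fun i => he i.castSucc
    obtain ⟨y, hy, hyF⟩ := (hF.extend _ hbF (e (Fin.last n)) (he _).1 (he _).2
      (k (Fin.last n))).1 (a (Fin.last n)) (ha _)
    refine ⟨(Fin.snoc b y : Fin (n + 1) → B.1),
      Fin.forall_fin_succ'.2 ⟨by simpa using hb, by simpa using hy⟩, ?_⟩
    rw [← tuplePosition_snoc] at hyF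
    simpa only [← Fin.init_def, Fin.snoc_init_self] using hyF

theorem flip (hF : IsBackForth G η S T F) (hξ : ξ ∈ V.D) (h0 : 0 < ξ) (hηξ : η < ξ) :
    IsBackForth G ξ T S
      {P | (∀ m ∈ P, m.eps ∈ V.D ∧ ξ < m.eps) ∧ P.map (Mark.flip ξ) ∈ F} where
  nil_mem := ⟨by simp, by simpa using hF.nil_mem⟩
  preserves := by
    rintro P ⟨hP, hPF⟩
    obtain ⟨n, b, a, e, k, rfl⟩ := exists_eq_tuplePosition P
    have he : ∀ i, e i ∈ V.D ∧ ξ < e i := fun i => hP _ ((List.mem_ofFn' _ _).2 ⟨i, rfl⟩)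
    rw [map_flip_tuplePosition] at hPF
    exact preserves_tuplePosition.2 <| (preserves_tuplePosition.1 (hF.preserves _ hPF)).symm
      (fun _ => hξ) (fun _ => h0) (fun i => (he i).1) fun i => (he i).2
  extend := by
    rintro P ⟨hP, hPF⟩ e he hξe k
    refine (hF.extend _ hPF ξ hξ hηξ ⌈(k : ℝ) * Real.exp e⌉₊).swap.mono fun b _ a _ hab =>
      ⟨fun m hm => ?_, by simpa [Mark.flip] using hab⟩
    obtain hm | rfl := by simpa only [List.mem_append, List.mem_singleton] using hm
    exacts [hP m hm, ⟨he, hξe⟩]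

end IsBackForth

theorem Survives.trans {F : Set (List (Mark (B.1 × C.1)))} (hF : IsBackForth G η T U F)
    (h0 : 0 ≤ ε) (hη : 0 ≤ η) (hε : ε + η < ε') {a : Fin n → A.1} {b : Fin n → B.1}
    {c : Fin n → C.1} {e₁ e₂ e : Fin n → ℝ} {k l : Fin n → ℕ}
    (he : ∀ i, (e₁ i ∈ V.D ∧ e₂ i ∈ V.D ∧ e i ∈ V.D) ∧ e₁ i + e₂ i ≤ e i ∧
      (k i : ℝ) * Real.exp (e₁ i) ≤ l i)
    (hbc : tuplePosition b c e₂ l ∈ F) (h : Survives G ε S T α (tuplePosition a b e₁ k)) :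
    Survives G ε' S U α (tuplePosition a c e k) := by
  induction α using WellFoundedLT.induction generalizing n with
  | ind α ih =>
    refine survives_iff.2 ⟨preserves_tuplePosition.2 <| (preserves_tuplePosition.1
      h.preserves).trans (preserves_tuplePosition.1 (hF.preserves _ hbc)) (fun i => (he i).1.1)
      (fun i => (he i).1.2.1) (fun i => (he i).1.2.2) (fun i => (he i).2.1) fun i => (he i).2.2,
      fun β hβ d hd hεd m => ?_⟩
    obtain ⟨d₁, hd₁, hεd₁, hlt⟩ := V.D_dense ε (ε' - η) h0 (by linarith)
    have hd₂ : d - d₁ ∈ V.D := V.sub_mem d hd d₁ hd₁ (by linarith)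
    refine ((h.biTotalOn hβ hd₁ hεd₁ m).comp (hF.extend _ hbc (d - d₁) hd₂ (by linarith)
      ⌈(m : ℝ) * Real.exp d₁⌉₊)).mono fun x _ z _ ⟨y, _, hxy, hyz⟩ => ?_
    rw [← tuplePosition_snoc] at hxy hyz ⊢
    refine ih β hβ (Fin.forall_fin_succ'.2 ?_) hyz hxy
    simp only [Fin.snoc_castSucc, Fin.snoc_last]
    exact ⟨he, ⟨hd₁, hd₂, hd⟩, by simp, Nat.le_ceil _⟩

/-- Opposite to points of `B` in a position that `II` survives there are points of `A` itself:
the position splits, up to the precision `ξ`, into one between `A` and `A` and one in `F`. -/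
theorem Survives.exists_internal_copy (hF : IsBackForth G η S T F) (hη : 0 ≤ η) (hξ : ξ ∈ V.D)
    (hηξ : η < ξ) (h0 : 0 ≤ ε) (hε : ε + ξ < ε') {a : Fin n → A.1} {b : Fin n → B.1}
    {e q : Fin n → ℝ} {k : Fin n → ℕ} (hb : ∀ i, b i ∈ T) (he : ∀ i, e i ∈ V.D)
    (hq : ∀ i, q i ∈ V.D ∧ e i + ξ < q i) (h : Survives G ε S T α (tuplePosition a b e k)) :
    ∃ c : Fin n → A.1, (∀ i, c i ∈ S) ∧ Survives G ε' S S α (tuplePosition a c q k) ∧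
      ∃ l : Fin n → ℕ, (∀ i, (k i : ℝ) * Real.exp (q i) ≤ l i) ∧
        tuplePosition c b (fun _ => ξ) l ∈ F := by
  have h0ξ := hη.trans_lt hηξ
  have hsub : ∀ i, q i - e i ∈ V.D ∧ ξ < q i - e i := fun i =>
    ⟨V.sub_mem _ (hq i).1 _ (he i) (by linarith [(hq i).2]), by linarith [(hq i).2]⟩
  obtain ⟨c, hc, hcF⟩ := (hF.flip hξ h0ξ hηξ).exists_extension
    (fun i => ⌈(k i : ℝ) * Real.exp (e i)⌉₊) hb hsub
  refine ⟨c, hc, h.trans (hF.flip hξ h0ξ hηξ) h0 h0ξ.le hε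
    (fun i => ⟨⟨he i, (hsub i).1, (hq i).1⟩, by simp, Nat.le_ceil _⟩) hcF, _, fun i => ?_,
    map_flip_tuplePosition .. ▸ hcF.2⟩
  calc (k i : ℝ) * Real.exp (q i)
      = k i * Real.exp (e i) * Real.exp (q i - e i) := by
        rw [mul_assoc, ← Real.exp_add, add_sub_cancel]
    _ ≤ ⌈(k i : ℝ) * Real.exp (e i)⌉₊ * Real.exp (q i - e i) := by gcongr; exact Nat.le_ceil _
    _ ≤ _ := Nat.le_ceil _

theorem stabilizes_of_isBackForth {Q : Set ℝ} (hQ : Q ⊆ V.D)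
    (hQd : ∀ x y : ℝ, 0 ≤ x → x < y → ∃ q ∈ Q, x < q ∧ q < y) (hS : S.Nonempty)
    (h : ∀ η > 0, ∃ F, IsBackForth G η S (Set.univ : Set B.1) F) :
    Stabilizes G B S (innerScottRank G Q S) := by
  intro ε _ h0 ε' _ hlt n a b e e' k ha he he' hs
  obtain ⟨ε₁, hε₁, hεε₁, hε₁ε'⟩ := V.D_dense ε ε' h0.le hlt
  have h0ε₁ := h0.trans hεε₁
  choose q hqQ hmax hqe' using fun i => hQd (max (e i) ε₁) (e' i) (h0ε₁.le.trans (le_max_right _ _))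
    (max_lt (he' i).2.2 (hε₁ε'.trans (he' i).2.1))
  obtain ⟨γ, hγ, hsmall⟩ := Pi.exists_forall_pos_add_lt
    (x := Sum.elim ![ε, ε₁] (Sum.elim e q)) (y := Sum.elim ![ε₁, ε'] (Sum.elim q e')) <| by
      simp only [Sum.forall, Fin.forall_fin_two, Sum.elim_inl, Sum.elim_inr]
      exact ⟨⟨hεε₁, hε₁ε'⟩, fun i => (le_max_left _ _).trans_lt (hmax i), hqe'⟩
  simp only [Sum.forall, Fin.forall_fin_two, Sum.elim_inl, Sum.elim_inr, Matrix.cons_val_zero,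
    Matrix.cons_val_one] at hsmall
  obtain ⟨⟨hγε, hγε₁⟩, hγe, hγq⟩ := hsmall
  obtain ⟨F, hF⟩ := h (γ / 2) (half_pos hγ)
  obtain ⟨ξ, hξ, hγξ, hξγ⟩ := V.D_dense (γ / 2) γ (half_pos hγ).le (half_lt_self hγ)
  obtain ⟨c, hc, hac, l, hl, hcF⟩ := hs.exists_internal_copy hF (half_pos hγ).le hξ hγξ h0.le
    (ε' := ε₁) (q := q) (by linarith) (fun _ => Set.mem_univ _) (fun i => (he i).1)
    fun i => ⟨hQ (hqQ i), by linarith [hγe i]⟩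
  have hgain : Survives G ε₁ S S (innerScottRank G Q S + 1) (tuplePosition a c q k) :=
    hac.of_watershed_le hS (watershed_le_innerScottRank k hε₁ h0ε₁ ha hc
      fun i => ⟨hqQ i, (le_max_right _ _).trans_lt (hmax i)⟩)
  exact hgain.trans hF h0ε₁.le (half_pos hγ).le (by linarith)
    (fun i => ⟨⟨hQ (hqQ i), hξ, (he' i).1⟩, by linarith [hγq i], hl i⟩) hcF

variable (G S) in
/-- The position `P` arises by relaxing the precisions of a position of sharper precisions, all
greater than `θ`, from which `II` can hold out for the time `α`. -/
def SharplySurvives (η : ℝ) (α : Ordinal.{u}) (θ : ℝ) (P : List (Mark (A.1 × B.1))) : Prop :=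
  ∃ (n : ℕ) (a : Fin n → A.1) (b : Fin n → B.1) (e d : Fin n → ℝ) (k : Fin n → ℕ),
    P = tuplePosition a b e k ∧ (∀ i, a i ∈ S) ∧ (∀ i, e i ∈ V.D ∧ η < e i) ∧
    (∀ i, d i ∈ V.D ∧ θ < d i ∧ d i < e i) ∧ Survives G θ S Set.univ α (tuplePosition a b d k)

namespace SharplySurvives

variable {θ : ℝ} {P : List (Mark (A.1 × B.1))}

theorem preserves (h : SharplySurvives G S η α θ P) : Preserves G P := by
  obtain ⟨n, a, b, e, d, k, rfl, -, he, hd, hs⟩ := h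
  exact preserves_tuplePosition.2 <| (preserves_tuplePosition.1 hs.preserves).mono
    (fun i => (hd i).1) (fun i => (he i).1) fun i => (hd i).2.2.le

theorem biTotalOn (h : SharplySurvives G S η α θ P) (hβ : β < α) (h0 : 0 ≤ θ) (hθ : θ < η) {e : ℝ}
    (he : e ∈ V.D) (hηe : η < e) (k : ℕ) :
    BiTotalOn S Set.univ fun a b => SharplySurvives G S η β θ (P ++ [⟨(a, b), e, k⟩]) := by
  obtain ⟨n, as, bs, es, ds, ks, rfl, has, hes, hds, hs⟩ := h
  obtain ⟨d, hd, hθd, hde⟩ := V.D_dense θ e h0 (hθ.trans hηe)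
  refine (hs.biTotalOn hβ hd hθd k).mono fun a ha b _ hab => ⟨n + 1,
    (Fin.snoc as a : Fin (n + 1) → A.1), (Fin.snoc bs b : Fin (n + 1) → B.1),
    (Fin.snoc es e : Fin (n + 1) → ℝ), (Fin.snoc ds d : Fin (n + 1) → ℝ),
    (Fin.snoc ks k : Fin (n + 1) → ℕ), (tuplePosition_snoc ..).symm, ?_, ?_, ?_,
    (tuplePosition_snoc ..).symm ▸ hab⟩
  all_goals simp only [Fin.forall_fin_succ', Fin.snoc_castSucc, Fin.snoc_last]
  exacts [⟨has, ha⟩, ⟨hes, he, hηe⟩, ⟨hds, hd, hθd, hde⟩]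

theorem exists_add_one (h : SharplySurvives G S η α θ P) (hstab : Stabilizes G B S α)
    (hθD : θ ∈ V.D) (h0 : 0 < θ) (hθ : θ < η) :
    ∃ θ' ∈ V.D, 0 < θ' ∧ θ' < η ∧ SharplySurvives G S η (α + 1) θ' P := by
  obtain ⟨n, a, b, e, d, k, rfl, ha, he, hd, hs⟩ := h
  obtain ⟨θ', hθ', hlt, hη⟩ := V.D_dense θ η h0.le hθ
  choose d' hd' hmax hde' using fun i => V.D_dense (max (d i) θ') (e i)
    ((h0.trans hlt).le.trans (le_max_right _ _)) (max_lt (hd i).2.2 (hη.trans (he i).2))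
  have hθd' : ∀ i, θ' < d' i := fun i => (le_max_right _ _).trans_lt (hmax i)
  exact ⟨θ', hθ', h0.trans hlt, hη, n, a, b, e, d', k, rfl, ha, he,
    fun i => ⟨hd' i, hθd' i, hde' i⟩, hstab θ hθD h0 θ' hθ' hlt n a b d d' k ha
      (fun i => ⟨(hd i).1, (hd i).2.1⟩)
      (fun i => ⟨hd' i, hθd' i, (le_max_left _ _).trans_lt (hmax i)⟩) hs⟩

end SharplySurvives

theorem Stabilizes.exists_isBackForth (hstab : Stabilizes G B S α)
    (hnil : ∀ ε ∈ V.D, 0 < ε → Survives G ε S (Set.univ : Set B.1) α []) (hη : 0 < η) :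
    ∃ F, IsBackForth G η S (Set.univ : Set B.1) F := by
  refine ⟨{P | ∃ θ ∈ V.D, 0 < θ ∧ θ < η ∧ SharplySurvives G S η α θ P}, ?_, ?_, ?_⟩
  · obtain ⟨θ, hθ, h0, hlt⟩ := V.D_dense 0 η le_rfl hη
    exact ⟨θ, hθ, h0, hlt, 0, Fin.elim0, Fin.elim0, Fin.elim0, Fin.elim0, Fin.elim0,
      by simp [tuplePosition], by simp, by simp, by simp,
      by simpa [tuplePosition] using hnil θ hθ h0⟩
  · exact fun P ⟨_, _, _, _, hP⟩ => hP.preserves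
  · rintro P ⟨θ, hθ, h0, hlt, hP⟩ e he hηe k
    obtain ⟨θ', hθ', h0', hlt', hP'⟩ := hP.exists_add_one hstab hθ h0 hlt
    exact (hP'.biTotalOn (lt_add_one α) h0'.le hlt' he hηe k).mono
      fun a _ b _ hab => ⟨θ', hθ', h0', hlt', hab⟩

theorem models_scottSentence_iff_exists_isBackForth {Q : Set ℝ} (hQ : Q ⊆ V.D)
    (hQd : ∀ x y : ℝ, 0 ≤ x → x < y → ∃ q ∈ Q, x < q ∧ q < y) (hS : S.Nonempty) :
    Formula.Models B.1 (scottSentence G Q S) ↔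
      ∀ η > 0, ∃ F, IsBackForth G η S (Set.univ : Set B.1) F := by
  rw [models_scottSentence_iff hS]
  refine ⟨fun ⟨hnil, hstab⟩ η hη => hstab.exists_isBackForth hnil hη,
    fun h => ⟨fun ε _ h0 => ?_, stabilizes_of_isBackForth hQ hQd hS h⟩⟩
  obtain ⟨F, hF⟩ := h ε h0
  exact hF.survives hF.nil_mem _

end BackForth

section Perturbations

variable {L : FirstOrder.Language.{u, u}} {K : Set (Bundled.{u} L.Structure)}
  {V : Approximations L K} {A B : K} {S : Set A.1}

namespace Approximations

theorem IsDense.exists_forall_dist_lt (hS : V.IsDense A S) (x : A.1) {ι : Type*} [Finite ι]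
    {r : ι → ℝ} (hr : ∀ i, 0 < r i) : ∃ y ∈ S, ∀ i, (V.metric A).dist x y < r i := by
  obtain ⟨r₀, hr₀, hle⟩ := Pi.exists_forall_pos_add_lt hr
  let _ := V.metric A
  obtain ⟨y, hy, hxy⟩ := Dense.exists_dist_lt hS x hr₀
  exact ⟨y, hy, fun i => hxy.trans (by simpa using hle i)⟩

theorem IsDense.nonempty (hS : V.IsDense A S) : S.Nonempty := by
  obtain ⟨x⟩ := V.nonempty A
  obtain ⟨y, hy, -⟩ := hS.exists_forall_dist_lt x (r := fun _ : Unit => 1) fun _ => one_pos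
  exact ⟨y, hy⟩

theorem IsDense.exists_answer_of_biTotalOn (hS : V.IsDense A S) {R : A.1 → B.1 → Prop}
    (h : BiTotalOn S Set.univ R) {ι : Type*} [Finite ι] {r : ι → ℝ} (hr : ∀ i, 0 < r i)
    (x : A.1 ⊕ B.1) :
    ∃ y : A.1 × B.1, Answers x y ∧ ∃ a, (∀ i, (V.metric A).dist y.1 a < r i) ∧ R a y.2 := by
  rcases x with c | b
  · obtain ⟨a, ha, hca⟩ := hS.exists_forall_dist_lt c hr
    obtain ⟨b, -, hab⟩ := h.1 a ha
    exact ⟨(c, b), Or.inl rfl, a, hca, hab⟩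
  · obtain ⟨a, -, hab⟩ := h.2 b (Set.mem_univ b)
    exact ⟨(a, b), Or.inr rfl, a, fun i => ((V.metric A).dist_self a).trans_lt (hr i), hab⟩

theorem IsDense.biTotalOn_of_forall_exists_answer (hS : V.IsDense A S) {R : A.1 → B.1 → Prop}
    {ι : Type*} [Finite ι] {r : ι → ℝ} (hr : ∀ i, 0 < r i)
    (h : ∀ x : A.1 ⊕ B.1, ∃ y : A.1 × B.1, Answers x y ∧
      ∀ a, (∀ i, (V.metric A).dist y.1 a < r i) → R a y.2) :
    BiTotalOn S Set.univ R := by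
  refine ⟨fun a _ => ?_, fun b _ => ?_⟩
  · obtain ⟨⟨a', b⟩, hy, hR⟩ := h (.inl a)
    obtain rfl : a = a' := by simpa [Answers] using hy
    exact ⟨b, Set.mem_univ b, hR a fun i => ((V.metric A).dist_self a).trans_lt (hr i)⟩
  · obtain ⟨⟨c, b'⟩, hy, hR⟩ := h (.inr b)
    obtain rfl : b = b' := by simpa [Answers] using hy
    obtain ⟨a, ha, hca⟩ := hS.exists_forall_dist_lt c hr
    exact ⟨a, ha, hR a hca⟩

end Approximations

theorem IsPerturbation.symm {ι : Type*} [LE ι] {δ : ℕ → ℝ} {a a' : ι → A.1} {k : ι → ℕ}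
    (h : IsPerturbation V δ a a' k) : IsPerturbation V δ a' a k :=
  fun i j hij => ((V.metric A).dist_comm _ _).trans_lt (h i j hij)

theorem IsPerturbation.succ {n : ℕ} {δ : ℕ → ℝ} {a a' : Fin (n + 1) → A.1} {k : Fin (n + 1) → ℕ}
    (h : IsPerturbation V δ (fun i : Fin n => a i.castSucc) (fun i => a' i.castSucc)
      fun i => k i.castSucc)
    (hlast : ∀ i, (V.metric A).dist (a (Fin.last n)) (a' (Fin.last n)) < δ (k i)) :
    IsPerturbation V δ a a' k := by
  intro i j hij
  induction j using Fin.lastCases with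
  | last => exact hlast i
  | cast j =>
    obtain ⟨i, rfl⟩ := Fin.exists_castSucc_eq.2 (hij.trans_lt (Fin.castSucc_lt_last j)).ne
    exact h i j hij

end Perturbations

section LongGame

variable {L : FirstOrder.Language.{u, u}} {K : Set (Bundled.{u} L.Structure)}
  {V : Approximations L K} {G : GoodSets V} {A B : K} {ε η ξ : ℝ} {S : Set A.1} {δ : ℕ → ℝ}

/-- A move of `I` in the long game: a point of one of the structures and a precision above `ε`. -/
abbrev LongMove (V : Approximations L K) (ε : ℝ) (A B : K) : Type u :=
  (A.1 ⊕ B.1) × {e : ℝ // e ∈ V.D ∧ ε < e}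

theorem winsInf_longGame_iff {p : ℕ → LongMove V ε A B × (A.1 × B.1)} :
    (longGame G ε A B).winsInf p ↔
      ApproxPreserves G (fun i => (p i).2.1) (fun i => (p i).2.2) (fun i => (p i).1.2) id :=
  Iff.rfl

/-- The position of the dynamic game that `II` keeps in a back-and-forth system while the rounds `r`
of the long game are played: `a` replaces the points of `A` by points of a dense set, and the
precisions and levels leave room for a perturbation of precision `ξ`. -/
def shadowPosition (ξ : ℝ) {n : ℕ}
    (r : Fin n → LongMove V ε A B × (A.1 × B.1)) (a : Fin n → A.1) :
    List (Mark (A.1 × B.1)) :=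
  tuplePosition a (fun i => (r i).2.2) (fun i => (r i).1.2 - ξ) fun i => ⌈(i : ℝ) * Real.exp ξ⌉₊

theorem shadowPosition_snoc {n : ℕ}
    (r : Fin n → LongMove V ε A B × (A.1 × B.1)) (a : Fin n → A.1)
    (x : LongMove V ε A B × (A.1 × B.1)) (c : A.1) :
    shadowPosition ξ (Fin.snoc r x : Fin (n + 1) → _) (Fin.snoc a c : Fin (n + 1) → A.1) =
      shadowPosition ξ r a ++ [⟨(c, x.2.2), x.1.2 - ξ, ⌈(n : ℝ) * Real.exp ξ⌉₊⟩] := by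
  rw [shadowPosition, tuplePosition, List.ofFn_succ', List.concat_eq_append]
  simp [shadowPosition, tuplePosition]

theorem winsInf_longGame_of_shadowPosition (hδ : IsModulus G A ξ δ) (hξ : ξ ∈ V.D) (hξε : ξ ≤ ε)
    {p : ℕ → LongMove V ε A B × (A.1 × B.1)}
    (h : ∀ n, ∃ a : Fin n → A.1, Preserves G (shadowPosition ξ (fun i : Fin n => p i) a) ∧
      IsPerturbation V δ (fun i : Fin n => (p i).2.1) a fun i => i) :
    (longGame G ε A B).winsInf p := by
  refine winsInf_longGame_iff.2 <| .of_forall_fin (fun i => (p i).1.2.2.1) fun n => ?_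
  obtain ⟨a, hP, ha⟩ := h n
  exact (hδ.approxPreserves ha).trans (preserves_tuplePosition.1 hP) (fun _ => hξ)
    (fun i => V.sub_mem _ (p i).1.2.2.1 _ hξ (hξε.trans (p i).1.2.2.2.le))
    (fun i => (p i).1.2.2.1) (fun _ => (add_sub_cancel _ _).le) fun _ => Nat.le_ceil _

theorem iiWins_longGame_of_isBackForth {F : Set (List (Mark (A.1 × B.1)))} (hS : V.IsDense A S)
    (hF : IsBackForth G η S (Set.univ : Set B.1) F) (hη : 0 ≤ η) (hε : η < ε) :
    (longGame G ε A B).IIWins := by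
  obtain ⟨ξ, hξ, h0, hξ1⟩ := V.D_dense 0 (ε - η) le_rfl (sub_pos.2 hε)
  obtain ⟨δ, hδ⟩ := exists_isModulus G A hξ h0
  have hξε : ξ ≤ ε := by linarith
  have : Nonempty (A.1 × B.1) := ⟨((V.nonempty A).some, (V.nonempty B).some)⟩
  refine Game.IIWins.of_invariant (fun h => ∃ (n : ℕ) (r : Fin n → _) (a : Fin n → A.1),
    h = List.ofFn r ∧ shadowPosition ξ r a ∈ F ∧
      IsPerturbation V δ (fun i => (r i).2.1) a fun i => i) ?_ ?_ (fun _ _ he => he.elim) ?_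
  · exact ⟨0, Fin.elim0, Fin.elim0, rfl, by simpa [shadowPosition, tuplePosition] using hF.nil_mem,
      fun i => i.elim0⟩
  · rintro _ ⟨x, e, he, hεe⟩ ⟨n, r, a, rfl, haF, ha⟩ - -
    obtain ⟨y, hy, c, hc, hcF⟩ := hS.exists_answer_of_biTotalOn
      (hF.extend _ haF (e - ξ) (V.sub_mem e he ξ hξ (by linarith)) (by linarith)
        ⌈(n : ℝ) * Real.exp ξ⌉₊) (r := fun i : Fin (n + 1) => δ i) (fun i => (hδ i).1) x
    refine ⟨y, hy, n + 1, Fin.snoc r ((x, ⟨e, he, hεe⟩), y), Fin.snoc a c, ?_, ?_, ?_⟩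
    · rw [List.ofFn_succ', List.concat_eq_append]
      simp
    · rwa [shadowPosition_snoc]
    · exact .succ (by simpa using ha) (by simpa using hc)
  · intro p hp
    refine winsInf_longGame_of_shadowPosition hδ hξ hξε fun n => ?_
    obtain ⟨m, r, a, hr, haF, ha⟩ := hp n
    obtain rfl : n = m := by simpa [Game.firstRounds] using congrArg List.length hr
    obtain rfl : (fun i : Fin n => p i) = r := List.ofFn_injective hr
    exact ⟨a, hF.preserves _ haF, ha⟩

/-- An infinite play of the long game in which `II` follows the strategy `τ` and `I` always chooses
the precision `d`. -/
def IsSteadyPlay (G : GoodSets V)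
    (τ : List (LongMove V ε A B × (A.1 × B.1)) → LongMove V ε A B → A.1 × B.1)
    (d : {e : ℝ // e ∈ V.D ∧ ε < e})
    (p : ℕ → LongMove V ε A B × (A.1 × B.1)) : Prop :=
  (∀ n, (longGame G ε A B).IsPlay (Game.firstRounds p n) ∧
    Game.FollowsII τ (Game.firstRounds p n)) ∧ ∀ n, (p n).1.2 = d

section SteadyPlay

variable {τ : List (LongMove V ε A B × (A.1 × B.1)) → LongMove V ε A B → A.1 × B.1}
  {d : {e : ℝ // e ∈ V.D ∧ ε < e}}
  (hτ : ∀ h x, (longGame G ε A B).IsPlay h → Game.FollowsII τ h → ¬ (longGame G ε A B).ended h →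
    (longGame G ε A B).legalI h x → (longGame G ε A B).legalII h x (τ h x))

include hτ

theorem isSteadyPlay_continuation
    {h : List (LongMove V ε A B × (A.1 × B.1))}
    (hplay : (longGame G ε A B).IsPlay h) (hfollows : Game.FollowsII τ h)
    (hd : ∀ r ∈ h, r.1.2 = d) (x : A.1 ⊕ B.1) :
    IsSteadyPlay G τ d (Game.continuation τ (fun _ => (x, d)) h) := by
  refine ⟨Game.isPlay_and_followsII_continuation (fun _ => not_false) hτ (fun _ _ => trivial)
    hplay hfollows, fun n => ?_⟩
  rcases lt_or_ge n h.length with hn | hn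
  · rw [Game.continuation, dif_pos hn]
    exact hd _ (List.getElem_mem hn)
  · rw [Game.continuation_of_length_le _ _ _ hn]

theorem IsSteadyPlay.exists_deviation
    {p : ℕ → LongMove V ε A B × (A.1 × B.1)}
    (hp : IsSteadyPlay G τ d p) (N : ℕ) (x : A.1 ⊕ B.1) :
    ∃ p', IsSteadyPlay G τ d p' ∧ (∀ i < N, p' i = p i) ∧ Answers x (p' N).2 := by
  have hlen : (Game.firstRounds p N).length = N := by simp [Game.firstRounds]
  have hp' := isSteadyPlay_continuation hτ (hp.1 N).1 (hp.1 N).2 (d := d) (fun r hr => by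
    obtain ⟨i, rfl⟩ := (List.mem_ofFn' _ _).1 hr
    exact hp.2 i) x
  refine ⟨_, hp', fun i hi => ?_, ?_⟩
  · rw [Game.continuation, dif_pos (hi.trans_eq hlen.symm)]
    simp [Game.firstRounds]
  · have hround := (hp'.1 (N + 1)).1
    rw [Game.firstRounds_succ, Game.isPlay_concat] at hround
    have hanswer : Answers (Game.continuation τ (fun _ => (x, d)) (Game.firstRounds p N) N).1.1
      (Game.continuation τ (fun _ => (x, d)) (Game.firstRounds p N) N).2 := hround.2.2.2
    rwa [Game.continuation_of_length_le _ _ _ hlen.le] at hanswer ⊢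

end SteadyPlay

/-- The positions read off from steady plays of precision `d`: the `i`-th mark belongs to the round
`t i`, which is late enough for formulas whose level has grown by the factor `e ^ ξ`, and its point
of `A` is a perturbation of the point played in that round. -/
def steadyPositions (G : GoodSets V) (η ξ : ℝ) (δ : ℕ → ℝ)
    (τ : List (LongMove V ε A B × (A.1 × B.1)) → LongMove V ε A B → A.1 × B.1)
    (d : {e : ℝ // e ∈ V.D ∧ ε < e}) : Set (List (Mark (A.1 × B.1))) :=
  {P | ∃ p, IsSteadyPlay G τ d p ∧ ∃ (n : ℕ) (t : Fin n → ℕ) (a : Fin n → A.1) (e : Fin n → ℝ)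
    (k : Fin n → ℕ), P = tuplePosition a (fun i => (p (t i)).2.2) e k ∧ Monotone t ∧
      (∀ i, e i ∈ V.D ∧ η < e i ∧ (k i : ℝ) * Real.exp ξ ≤ t i) ∧
        IsPerturbation V δ (fun i => (p (t i)).2.1) a k}

section SteadyPositions

variable {τ : List (LongMove V ε A B × (A.1 × B.1)) → LongMove V ε A B → A.1 × B.1}
  {d : {e : ℝ // e ∈ V.D ∧ ε < e}} {P : List (Mark (A.1 × B.1))}

theorem preserves_of_mem_steadyPositions (hδ : IsModulus G A ξ δ) (hξ : ξ ∈ V.D)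
    (hdη : ξ + d ≤ η)
    (hwin : ∀ p, (∀ n, (longGame G ε A B).IsPlay (Game.firstRounds p n) ∧
      Game.FollowsII τ (Game.firstRounds p n)) → (longGame G ε A B).winsInf p)
    (hP : P ∈ steadyPositions G η ξ δ τ d) : Preserves G P := by
  obtain ⟨p, hp, n, t, a, e, k, rfl, ht, he, ha⟩ := hP
  have hplay := (winsInf_longGame_iff.1 (hwin p hp.1)).comp t t ht
  simp only [hp.2, id] at hplay
  exact preserves_tuplePosition.2 <| (hδ.approxPreserves ha.symm).trans hplay (fun _ => hξ)
    (fun _ => d.2.1) (fun i => (he i).1) (fun i => hdη.trans (he i).2.1.le) fun i => (he i).2.2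

theorem exists_answer_mem_steadyPositions
    (hτ : ∀ h x, (longGame G ε A B).IsPlay h → Game.FollowsII τ h → ¬ (longGame G ε A B).ended h →
      (longGame G ε A B).legalI h x → (longGame G ε A B).legalII h x (τ h x))
    (hP : P ∈ steadyPositions G η ξ δ τ d) {c : ℝ} (hc : c ∈ V.D) (hηc : η < c) (l : ℕ) :
    ∃ (n : ℕ) (k : Fin (n + 1) → ℕ), ∀ x : A.1 ⊕ B.1, ∃ y : A.1 × B.1, Answers x y ∧
      ∀ z, (∀ i, (V.metric A).dist y.1 z < δ (k i)) →
        P ++ [⟨(z, y.2), c, l⟩] ∈ steadyPositions G η ξ δ τ d := by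
  obtain ⟨p, hp, n, t, a, e, k, rfl, ht, he, ha⟩ := hP
  obtain ⟨N₀, hN₀⟩ := (Set.finite_range t).bddAbove
  obtain ⟨N, hN, hl⟩ : ∃ N, (∀ i, t i < N) ∧ (l : ℝ) * Real.exp ξ ≤ N :=
    ⟨max (N₀ + 1) ⌈(l : ℝ) * Real.exp ξ⌉₊,
      fun i => lt_max_of_lt_left (Nat.lt_succ_of_le (hN₀ ⟨i, rfl⟩)),
      (Nat.le_ceil _).trans (Nat.cast_le.2 (le_max_right _ _))⟩
  refine ⟨n, Fin.snoc k l, fun x => ?_⟩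
  obtain ⟨p', hp', hagree, hanswer⟩ := hp.exists_deviation hτ N x
  have hpt : ∀ i, p' (t i) = p (t i) := fun i => hagree _ (hN i)
  refine ⟨_, hanswer, fun z hz => ⟨p', hp', n + 1, Fin.snoc t N, Fin.snoc a z, Fin.snoc e c,
    Fin.snoc k l, ?_, ?_, ?_, ?_⟩⟩
  · rw [← tuplePosition_snoc]
    congr 1
    exact funext (Fin.forall_fin_succ'.2 ⟨fun i => by simp [hpt], by simp⟩)
  · intro i j hij
    induction j using Fin.lastCases with
    | last => exact Fin.lastCases (by simp) (fun i => by simpa using (hN i).le) i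
    | cast j =>
      obtain ⟨i, rfl⟩ := Fin.exists_castSucc_eq.2 (hij.trans_lt (Fin.castSucc_lt_last j)).ne
      simpa using ht hij
  · exact Fin.forall_fin_succ'.2 ⟨by simpa using he, by simpa using ⟨hc, hηc, hl⟩⟩
  · exact .succ (by simpa [hpt] using ha) (by simpa using hz)

end SteadyPositions

theorem exists_isBackForth_of_iiWins (hS : V.IsDense A S) (hwins : (longGame G ε A B).IIWins)
    (hε : 0 ≤ ε) (hη : ε < η) : ∃ F, IsBackForth G η S (Set.univ : Set B.1) F := by
  obtain ⟨τ, hτ, -, hwin⟩ := hwins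
  obtain ⟨ξ, hξ, h0, hξ1⟩ := V.D_dense 0 (η - ε) le_rfl (sub_pos.2 hη)
  obtain ⟨d, hd, hεd, hdη⟩ := V.D_dense ε (η - ξ) hε (by linarith)
  obtain ⟨δ, hδ⟩ := exists_isModulus G A hξ h0
  obtain ⟨x⟩ := V.nonempty A
  refine ⟨steadyPositions G η ξ δ τ ⟨d, hd, hεd⟩, ?_,
    fun P hP => preserves_of_mem_steadyPositions hδ hξ (by dsimp only; linarith) hwin hP,
    fun P hP c hc hηc l => ?_⟩
  · exact ⟨_,
      isSteadyPlay_continuation hτ Game.isPlay_nil (Game.followsII_nil τ) (by simp) (.inl x),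
      0, Fin.elim0, Fin.elim0, Fin.elim0, Fin.elim0, by simp [tuplePosition], fun i => i.elim0,
      fun i => i.elim0, fun i => i.elim0⟩
  · obtain ⟨n, k, hk⟩ := exists_answer_mem_steadyPositions hτ hP hc hηc l
    exact hS.biTotalOn_of_forall_exists_answer (fun i => (hδ (k i)).1) hk

theorem models_scottSentence_iff_iiWins {Q : Set ℝ} (hQ : Q ⊆ V.D)
    (hQd : ∀ x y : ℝ, 0 ≤ x → x < y → ∃ q ∈ Q, x < q ∧ q < y) (hS : V.IsDense A S) :
    Formula.Models B.1 (scottSentence G Q S) ↔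
      ∀ ε : ℝ, 0 < ε → (longGame G ε A B).IIWins := by
  rw [models_scottSentence_iff_exists_isBackForth hQ hQd hS.nonempty]
  refine ⟨fun h ε hε => ?_, fun h η hη =>
    exists_isBackForth_of_iiWins hS (h _ (half_pos hη)) (half_pos hη).le (half_lt_self hη)⟩
  obtain ⟨F, hF⟩ := h _ (half_pos hε)
  exact iiWins_longGame_of_isBackForth hS hF (half_pos hε).le (half_lt_self hε)

theorem iiWins_longGame_of_mem (I : IsoNotion V) (hε : ε ∈ V.D) (hη : ε < η) {f : A.1 → B.1}
    (hf : f ∈ I.mem ε A B) : (longGame G η A B).IIWins := by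
  have : Nonempty (A.1 × B.1) := ⟨((V.nonempty A).some, (V.nonempty B).some)⟩
  have hsurj := (I.bijective ε hε A B f hf).surjective
  refine Game.IIWins.of_invariant (fun h => ∀ r ∈ h, r.2.2 = f r.2.1) (by simp) ?_
    (fun _ _ he => he.elim) ?_
  · rintro h ⟨x, e⟩ hJ - -
    obtain ⟨y, hy, hyf⟩ : ∃ y : A.1 × B.1, Answers x y ∧ y.2 = f y.1 := by
      rcases x with a | b
      · exact ⟨(a, f a), Or.inl rfl, rfl⟩
      · obtain ⟨a, rfl⟩ := hsurj b
        exact ⟨(a, f a), Or.inr rfl, rfl⟩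
    exact ⟨y, hy, List.forall_mem_append.2 ⟨hJ, List.forall_mem_singleton.2 hyf⟩⟩
  · intro p hp k φ _ i _ hr
    have hpf : ∀ n, (p n).2.2 = f (p n).2.1 := fun n =>
      hp (n + 1) (p n) (by rw [Game.firstRounds_succ]; simp)
    simp only [hpf]
    exact Approximations.realize_appr_mono hε (p k).1.2.2.1 (hη.trans (p k).1.2.2.2).le
      ((I.mem_iff ε hε A B f hsurj).1 hf φ _ hr)

end LongGame

section ClusterPoints

theorem mapClusterPt_unpair_of_denseRange {X : Type*} [TopologicalSpace X] {d : ℕ → X}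
    (hd : DenseRange d) (x : X) : MapClusterPt x atTop fun n : ℕ => d n.unpair.1 := by
  refine mapClusterPt_iff_frequently.2 fun U hU => frequently_atTop.2 fun N => ?_
  obtain ⟨m, hm⟩ := hd.mem_nhds hU
  exact ⟨Nat.pair m N, Nat.right_le_pair m N, by simpa using hm⟩

theorem mapClusterPt_of_answers {X Y : Type u} [TopologicalSpace X] [TopologicalSpace Y]
    {z : ℕ → X ⊕ Y} {a : ℕ → X} {b : ℕ → Y} (h : ∀ n, Answers (z n) (a n, b n)) :
    (∀ x, MapClusterPt (Sum.inl x) atTop z → MapClusterPt x atTop a) ∧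
      ∀ y, MapClusterPt (Sum.inr y) atTop z → MapClusterPt y atTop b := by
  constructor
  · refine fun x hx => mapClusterPt_iff_frequently.2 fun U hU =>
      (hx.frequently (isOpenMap_inl.image_mem_nhds hU)).mono ?_
    rintro n ⟨c, hc, hcz⟩
    have hca : c = a n := by simpa [Answers, ← hcz] using h n
    exact hca ▸ hc
  · refine fun y hy => mapClusterPt_iff_frequently.2 fun U hU =>
      (hy.frequently (isOpenMap_inr.image_mem_nhds hU)).mono ?_
    rintro n ⟨c, hc, hcz⟩
    have hcb : c = b n := by simpa [Answers, ← hcz] using h n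
    exact hcb ▸ hc

theorem exists_mapClusterPt_prodMk {X Y : Type*} [UniformSpace X] [FirstCountableTopology X]
    [UniformSpace Y] [CompleteSpace Y] {a : ℕ → X} {b : ℕ → Y}
    (hab : ∀ s : ℕ → ℕ, StrictMono s → CauchySeq (a ∘ s) → CauchySeq (b ∘ s)) {x : X}
    (hx : MapClusterPt x atTop a) : ∃ y, MapClusterPt (x, y) atTop fun n => (a n, b n) := by
  obtain ⟨s, hs, hxs⟩ := hx.tendsto_subseq
  obtain ⟨y, hy⟩ := cauchySeq_tendsto_of_complete (hab s hs hxs.cauchySeq)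
  exact ⟨y, (hxs.prodMk_nhds hy).mapClusterPt.of_comp hs.tendsto_atTop⟩

variable {X Y : Type*} [MetricSpace X] [MetricSpace Y] {a : ℕ → X} {b : ℕ → Y}

theorem eq_of_mapClusterPt_prodMk [CompleteSpace Y]
    (hab : ∀ s : ℕ → ℕ, StrictMono s → CauchySeq (a ∘ s) → CauchySeq (b ∘ s)) {x : X} {y z : Y}
    (hy : MapClusterPt (x, y) atTop fun n => (a n, b n))
    (hz : MapClusterPt (x, z) atTop fun n => (a n, b n)) : y = z := by
  -- a subsequence along which `a` converges to `x` while `b` alternates between `y` and `z`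
  let t : ℕ → Y := fun n => if Even n then y else z
  have hfreq (n : ℕ) : ∃ᶠ k in atTop, dist (a k, b k) (x, t n) < 1 / ((n : ℝ) + 1) := by
    have hmem (w : Y) : Metric.ball (x, w) (1 / ((n : ℝ) + 1)) ∈ 𝓝 (x, w) :=
      Metric.ball_mem_nhds _ (by positivity)
    by_cases hn : Even n
    · simpa only [t, if_pos hn] using hy.frequently (hmem y)
    · simpa only [t, if_neg hn] using hz.frequently (hmem z)
  obtain ⟨s, hs, hdist⟩ := extraction_forall_of_frequently hfreq
  have hlim : Tendsto (fun n => dist (a (s n), b (s n)) (x, t n)) atTop (𝓝 0) :=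
    squeeze_zero (fun _ => dist_nonneg) (fun n => (hdist n).le)
      tendsto_one_div_add_atTop_nhds_zero_nat
  have ha : Tendsto (a ∘ s) atTop (𝓝 x) := tendsto_iff_dist_tendsto_zero.2 <|
    squeeze_zero (fun _ => dist_nonneg) (fun _ => le_max_left _ _) hlim
  obtain ⟨w, hw⟩ := cauchySeq_tendsto_of_complete (hab s hs ha.cauchySeq)
  have ht : Tendsto t atTop (𝓝 w) := (tendsto_iff_of_dist <|
    squeeze_zero (fun _ => dist_nonneg) (fun _ => le_max_right _ _) hlim).1 hw
  have hyw : Tendsto (fun _ : ℕ => y) atTop (𝓝 w) := by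
    simpa [t, Function.comp_def] using
      ht.comp (strictMono_nat_of_lt_succ (f := (2 * ·)) (by simp)).tendsto_atTop
  have hzw : Tendsto (fun _ : ℕ => z) atTop (𝓝 w) := by
    simpa [t, Function.comp_def] using
      ht.comp (strictMono_nat_of_lt_succ (f := (2 * · + 1)) (by simp)).tendsto_atTop
  exact (tendsto_const_nhds_iff.1 hyw).trans (tendsto_const_nhds_iff.1 hzw).symm

theorem exists_surjective_forall_mapClusterPt [CompleteSpace X] [CompleteSpace Y]
    (hab : ∀ s : ℕ → ℕ, StrictMono s → (CauchySeq (a ∘ s) ↔ CauchySeq (b ∘ s)))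
    (ha : ∀ x, MapClusterPt x atTop a) (hb : ∀ y, MapClusterPt y atTop b) :
    ∃ f : X → Y, Function.Surjective f ∧
      ∀ x, MapClusterPt (x, f x) atTop fun n => (a n, b n) := by
  have hab' := fun s hs => (hab s hs).1
  choose f hf using fun x => exists_mapClusterPt_prodMk hab' (ha x)
  refine ⟨f, fun y => ?_, hf⟩
  obtain ⟨x, hx⟩ := exists_mapClusterPt_prodMk (fun s hs => (hab s hs).2) (hb y)
  exact ⟨x, eq_of_mapClusterPt_prodMk hab' (hf x) <|
    hx.continuousAt_comp continuous_swap.continuousAt⟩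

end ClusterPoints

section Isomorphism

variable {L : FirstOrder.Language.{u, u}} {K : Set (Bundled.{u} L.Structure)}
  {V : Approximations L K} {G : GoodSets V} {A B : K} {ε : ℝ}

theorem Approximations.exists_antitone_tendsto (V : Approximations L K) (hε : 0 ≤ ε) :
    ∃ e : ℕ → ℝ, (∀ n, e n ∈ V.D ∧ ε < e n) ∧ Antitone e ∧ Tendsto e atTop (𝓝 ε) := by
  obtain ⟨r, hr, hεr, hlim⟩ := exists_seq_strictAnti_tendsto ε
  choose e he hlt hgt using fun n =>
    V.D_dense (r (n + 1)) (r n) (hε.trans (hεr _).le) (hr n.lt_succ_self)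
  exact ⟨e, fun n => ⟨he n, (hεr _).trans (hlt n)⟩,
    antitone_nat_of_succ_le fun n => ((hgt (n + 1)).trans (hlt n)).le,
    tendsto_of_tendsto_of_tendsto_of_le_of_le tendsto_const_nhds hlim
      (fun n => ((hεr _).trans (hlt n)).le) fun n => (hgt n).le⟩

theorem exists_approxPreserves_of_iiWins (hwins : (longGame G ε A B).IIWins)
    (z : ℕ → A.1 ⊕ B.1) {e : ℕ → ℝ} (he : ∀ n, e n ∈ V.D ∧ ε < e n) :
    ∃ (a : ℕ → A.1) (b : ℕ → B.1), (∀ n, Answers (z n) (a n, b n)) ∧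
      ApproxPreserves G a b e id := by
  obtain ⟨τ, hτ, -, hwin⟩ := hwins
  let f : ℕ → LongMove V ε A B := fun n => (z n, ⟨e n, he n⟩)
  let p := Game.continuation τ f []
  have hpf (n : ℕ) : (p n).1 = f n := by
    simp only [p, Game.continuation_of_length_le τ f [] n.zero_le]
  have hp := Game.isPlay_and_followsII_continuation (f := f) (fun _ => not_false) hτ
    (fun _ _ => trivial) Game.isPlay_nil (Game.followsII_nil τ)
  refine ⟨fun n => (p n).2.1, fun n => (p n).2.2, fun n => ?_, ?_⟩
  · have hplay := (hp (n + 1)).1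
    rw [Game.firstRounds_succ, Game.isPlay_concat] at hplay
    have hans : Answers (p n).1.1 (p n).2 := hplay.2.2.2
    rwa [hpf] at hans
  · have hpres := winsInf_longGame_iff.1 (hwin p hp)
    simpa only [hpf] using hpres

theorem ApproxPreserves.realize_appr_of_mapClusterPt (hε : ε ∈ V.D) {a : ℕ → A.1} {b : ℕ → B.1}
    {e : ℕ → ℝ} (h : ApproxPreserves G a b e id) (he : ∀ n, e n ∈ V.D)
    (hlim : Tendsto e atTop (𝓝 ε)) {v : ℕ → A.1} {w : ℕ → B.1}
    (hvw : letI := V.metric A; letI := V.metric B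
      ∀ x, MapClusterPt (v x, w x) atTop fun n => (a n, b n))
    {φ : Atom L} (hv : φ.Realize v) : (V.appr φ ε).Realize w := by
  let _ := V.metric A
  let _ := V.metric B
  obtain ⟨k, ψ, hψ, hφψ⟩ := G.exists_good φ
  rw [(hφψ B _).2 ε hε, V.realize_iff]
  rw [(hφψ A v).1] at hv
  intro ζ hζ hζ0
  rw [V.appr_appr ψ ε hε ζ hζ]
  obtain ⟨ξ, hξ, hξ0, hξζ⟩ := V.D_dense 0 (ζ / 3) le_rfl (by positivity)
  obtain ⟨δ, hδ⟩ := exists_isModulus G A hξ hξ0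
  obtain ⟨δ', hδ'⟩ := exists_isModulus G B hξ hξ0
  obtain ⟨m, hem, hkm⟩ := ((hlim.eventually (gt_mem_nhds (show ε < ε + ζ / 3 by linarith))).and
    (eventually_ge_atTop ⌈(k : ℝ) * Real.exp ξ⌉₊)).exists
  set l := ⌈(m : ℝ) * Real.exp (e m)⌉₊
  have hnear (x : ℕ) : ∃ n ≥ m, dist (a n) (v x) < δ k ∧ dist (b n) (w x) < δ' l :=
    frequently_atTop.1 ((hvw x).frequently <| prod_mem_nhds (Metric.ball_mem_nhds _ (hδ k).1)
      (Metric.ball_mem_nhds _ (hδ' l).1)) m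
  choose n hnm hna hnb using hnear
  have hva : ApproxPreserves G v (a ∘ n) (fun _ => ξ) fun _ => k :=
    hδ.approxPreserves fun _ j _ => (dist_comm _ _).trans_lt (hna j)
  have hab : ApproxPreserves G (a ∘ n) (b ∘ n) (fun _ => e m) fun _ => m :=
    h.comp n (fun _ => m) fun _ j _ => hnm j
  have hbw : ApproxPreserves G (b ∘ n) w (fun _ => ξ) fun _ => l :=
    hδ'.approxPreserves fun _ j _ => hnb j
  have haw : ApproxPreserves G (a ∘ n) w (fun _ => e m + ξ) fun _ => m :=
    hab.trans hbw (fun _ => he m) (fun _ => hξ) (fun _ => V.add_mem _ (he m) _ hξ)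
      (fun _ => le_rfl) fun _ => Nat.le_ceil _
  have hvw' : ApproxPreserves G v w (fun _ => ε + ζ) fun _ => k :=
    hva.trans haw (fun _ => hξ) (fun _ => V.add_mem _ (he m) _ hξ) (fun _ => V.add_mem _ hε _ hζ)
      (fun _ => by linarith) fun _ => Nat.ceil_le.1 hkm
  exact hvw' 0 ψ hψ id (fun x => x.zero_le) hv

theorem exists_mem_of_iiWins (I : IsoNotion V) (hA : V.IsSeparable A) (hB : V.IsSeparable B)
    (hε : ε ∈ V.D) (hwins : (longGame G ε A B).IIWins) : ∃ f, f ∈ I.mem ε A B := by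
  let _ := V.metric A
  let _ := V.metric B
  have : Nonempty A.1 := V.nonempty A
  have : TopologicalSpace.SeparableSpace A.1 := hA
  have : TopologicalSpace.SeparableSpace B.1 := hB
  have : CompleteSpace A.1 := V.complete A
  have : CompleteSpace B.1 := V.complete B
  obtain ⟨e, he, hanti, hlim⟩ := V.exists_antitone_tendsto (V.D_nonneg ε hε)
  -- `I` plays every point of a countable dense set infinitely often
  obtain ⟨a, b, hans, hab⟩ := exists_approxPreserves_of_iiWins hwins
    (fun n : ℕ => TopologicalSpace.denseSeq (A.1 ⊕ B.1) n.unpair.1) he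
  have hz := mapClusterPt_unpair_of_denseRange (TopologicalSpace.denseRange_denseSeq (A.1 ⊕ B.1))
  obtain ⟨hcla, hclb⟩ := mapClusterPt_of_answers hans
  obtain ⟨f, hsurj, hf⟩ := exists_surjective_forall_mapClusterPt
    (G.cauchy A B ε hε a b e he hanti hlim hab) (fun x => hcla x (hz _)) fun y => hclb y (hz _)
  exact ⟨f, (I.mem_iff ε hε A B f hsurj).2 fun φ v hv =>
    hab.realize_appr_of_mapClusterPt hε (fun n => (he n).1) hlim (fun x => hf (v x)) hv⟩

theorem IsoNotion.isoDist_eq_zero_iff (I : IsoNotion V) : I.isoDist A B = 0 ↔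
    ∀ ε ∈ V.D, 0 < ε → ∃ f, f ∈ I.mem ε A B := by
  constructor
  · intro h ε hε h0
    have hlt : I.isoDist A B < ENNReal.ofReal ε := by rwa [h, ENNReal.ofReal_pos]
    simp only [IsoNotion.isoDist, iInf_lt_iff] at hlt
    obtain ⟨δ, ⟨hδ, f, hf⟩, hδε⟩ := hlt
    exact ⟨f, I.mono δ hδ ε hε ((ENNReal.ofReal_lt_ofReal_iff h0).1 hδε).le A B hf⟩
  · intro h
    refine le_antisymm (ENNReal.le_of_forall_pos_le_add fun δ hδ _ => ?_) bot_le
    obtain ⟨ε, hε, h0, hεδ⟩ := V.D_dense 0 δ le_rfl hδ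
    calc I.isoDist A B ≤ ENNReal.ofReal ε := iInf₂_le ε ⟨hε, h ε hε h0⟩
      _ ≤ ENNReal.ofReal δ := ENNReal.ofReal_le_ofReal hεδ.le
      _ = 0 + δ := by rw [ENNReal.ofReal_coe_nnreal, zero_add]

end Isomorphism

section CountableRank

variable {L : FirstOrder.Language.{u, u}} {K : Set (Bundled.{u} L.Structure)}
  {V : Approximations L K} {G : GoodSets V} {A B : K} {ε : ℝ} {S : Set A.1} {T : Set B.1}
  {P : List (Mark (A.1 × B.1))}

theorem exists_lt_omega_one_not_survives (hS : S.Nonempty) (hSc : S.Countable) (hTc : T.Countable)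
    {α : Ordinal.{u}} (h : ¬ Survives G ε S T α P) : ∃ β < ω₁, ¬ Survives G ε S T β P := by
  induction α using WellFoundedLT.induction generalizing P with
  | ind α ih =>
    rcases eq_or_ne α 0 with rfl | hα
    · exact ⟨0, Ordinal.omega_pos 1, h⟩
    obtain ⟨x, ⟨hx, hD, hε, hxα⟩, hlost⟩ :=
      exists_move_of_not_survives (pos_iff_ne_zero.2 hα) hS h
    choose β hβ hnot using fun (y : S ×ˢ T) (hy : Answers x.pt y.1) =>
      ih _ hxα (hlost y.1 ⟨hy, y.2.1, y.2.2⟩)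
    have := (hSc.prod hTc).to_subtype
    -- one clock that lets `I` beat all of the countably many answers
    let γ : Ordinal.{u} := ⨆ y : {y : S ×ˢ T // Answers x.pt y.1}, β y.1 y.2
    have hγ : γ < ω₁ := Ordinal.iSup_lt_omega_one fun y => hβ y.1 y.2
    refine ⟨γ + 1, (Cardinal.isSuccLimit_omega 1).add_one_lt hγ, fun hs => ?_⟩
    obtain ⟨y, ⟨hans, hyS, hyT⟩, hsurv⟩ :=
      biTotalOn_iff_forall_answers.1 (hs.biTotalOn (lt_add_one γ) hD hε x.lvl) x.pt hx
    exact hnot ⟨y, hyS, hyT⟩ hans <| hsurv.mono <|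
      Ordinal.le_iSup (fun y : {y : S ×ˢ T // Answers x.pt y.1} => β y.1 y.2)
        ⟨⟨y, hyS, hyT⟩, hans⟩

theorem watershed_lt_omega_one (hS : S.Nonempty) (hSc : S.Countable) (hTc : T.Countable) :
    watershed G ε S T P < ω₁ := by
  rcases Set.eq_empty_or_nonempty {α | (dynGame G α ε S T P).IWins} with hempty | ⟨α, hα⟩
  · rw [watershed, hempty, Ordinal.sInf_empty]
    exact Ordinal.omega_pos 1
  · obtain ⟨β, hβ, hnot⟩ :=
      exists_lt_omega_one_not_survives hS hSc hTc ((iWins_dynGame_iff hS).1 hα)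
    have hwins : β ∈ {α | (dynGame G α ε S T P).IWins} := (iWins_dynGame_iff hS).2 hnot
    exact (csInf_le' hwins).trans_lt hβ

theorem innerScottRank_lt_omega_one {Q : Set ℝ} (hD : V.D.Countable) (hQ : Q.Countable)
    (hS : S.Nonempty) (hSc : S.Countable) : innerScottRank G Q S < ω₁ := by
  have := hSc.to_subtype
  have : Countable {e : ℝ // e ∈ V.D ∧ 0 < e} := (hD.mono fun _ h => h.1).to_subtype
  have (x : ℝ) : Countable {q : ℝ // q ∈ Q ∧ x < q} := (hQ.mono fun _ h => h.1).to_subtype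
  exact Ordinal.iSup_lt_omega_one fun ε => Ordinal.iSup_lt_omega_one fun n =>
    Ordinal.iSup_lt_omega_one fun e => Ordinal.iSup_lt_omega_one fun k =>
    Ordinal.iSup_lt_omega_one fun a => Ordinal.iSup_lt_omega_one fun b =>
    watershed_lt_omega_one hS hSc hSc

end CountableRank

instance Atom.instCountable {L : FirstOrder.Language.{u, u}} [Countable L.Symbols] :
    Countable (Atom L) := by
  have : Countable (Σ l, L.Relations l) :=
    (Sum.inr_injective (α := Σ l, L.Functions l)).countable
  have (l : ℕ) : Countable (L.Relations l) := (sigma_mk_injective (i := l)).countable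
  let f : Atom L → Σ n, L.Relations n × (Fin n → L.Term ℕ) := fun φ => ⟨φ.arity, φ.rel, φ.args⟩
  have hf : f.Injective := by
    rintro ⟨n, r, t⟩ ⟨n', r', t'⟩ h
    obtain ⟨rfl, h⟩ := Sigma.mk.inj_iff.1 h
    obtain ⟨rfl, rfl⟩ := Prod.mk.inj (eq_of_heq h)
    rfl
  exact hf.countable

namespace Formula

variable {L : FirstOrder.Language.{u, u}} {n : ℕ} {ι : Type u} {φ : ι → Formula L}
  {ψ χ : Formula L}

/-- A formula of `L_{ω₁}` whose free variables are among `v₀, …, v_{n-1}`. -/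
def InFirst (n : ℕ) (φ : Formula L) : Prop :=
  φ.InLogic ℵ₁ ∧ φ.free ⊆ Set.Iio n

theorem inFirst_conj_of_countable_range (hφ : (Set.range φ).Countable)
    (h : ∀ i, InFirst n (φ i)) : InFirst n (conj ι φ) :=
  ⟨⟨Cardinal.lt_aleph_one_iff.2 (Cardinal.le_aleph0_iff_set_countable.2 hφ),
    ⟨Finset.range n, fun i => (Finset.coe_range n).symm ▸ (h i).2⟩, fun i => (h i).1⟩,
    Set.iUnion_subset fun i => (h i).2⟩

theorem inFirst_conj [Countable ι] (h : ∀ i, InFirst n (φ i)) : InFirst n (conj ι φ) :=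
  inFirst_conj_of_countable_range (Set.countable_range φ) h

theorem inFirst_disj [Countable ι] (h : ∀ i, InFirst n (φ i)) : InFirst n (disj ι φ) :=
  inFirst_conj h

theorem inFirst_conjSmall {ι : Type} [Countable ι] {φ : ι → Formula L}
    (h : ∀ i, InFirst n (φ i)) : InFirst n (conjSmall φ) :=
  inFirst_conj fun i => h i.down

namespace InFirst

theorem and (hψ : InFirst n ψ) (hχ : InFirst n χ) : InFirst n (ψ.and χ) :=
  inFirst_conjSmall fun b => by cases b <;> assumption

theorem or (hψ : InFirst n ψ) (hχ : InFirst n χ) : InFirst n (ψ.or χ) :=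
  hψ.and hχ

theorem all (h : InFirst (n + 1) ψ) : InFirst n (all n ψ) :=
  ⟨h.1, fun _ hx => lt_of_le_of_ne (Nat.le_of_lt_succ (h.2 hx.1)) hx.2⟩

theorem ex (h : InFirst (n + 1) ψ) : InFirst n (ex n ψ) :=
  h.all

theorem allFirst (h : InFirst n ψ) : InFirst 0 (allFirst n ψ) := by
  induction n generalizing ψ with
  | zero => exact h
  | succ n ih => exact ih h.all

theorem isSentenceOf (h : InFirst 0 ψ) : ψ.IsSentenceOf ℵ₁ :=
  ⟨h.1, Set.eq_empty_of_subset_empty fun x hx => Nat.not_lt_zero x (h.2 hx)⟩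

end InFirst

end Formula

section CountableLogic

variable {L : FirstOrder.Language.{u, u}} {K : Set (Bundled.{u} L.Structure)}
  {V : Approximations L K} {G : GoodSets V} {A : K} {S : Set A.1}

namespace Approximations

theorem free_not_subset (V : Approximations L K) (φ : Formula L) : (V.not φ).free ⊆ φ.free := by
  induction φ with
  | atom φ =>
    refine Set.iUnion_subset fun ε => ?_
    simp only [Formula.free, V.vars_neg, V.vars_appr φ _ ε.down.2.1, subset_rfl]
  | all x φ ih => exact Set.sdiff_subset_sdiff_left ih
  | ex x φ ih => exact Set.sdiff_subset_sdiff_left ih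
  | conj ι φ ih => exact Set.iUnion_mono ih
  | disj ι φ ih => exact Set.iUnion_mono ih

theorem inLogic_not (hD : V.D.Countable) {φ : Formula L} (h : φ.InLogic ℵ₁) :
    (V.not φ).InLogic ℵ₁ := by
  have hrange {ι : Type u} (φ : ι → Formula L) (hφ : #(Set.range φ) < ℵ₁) :
      #(Set.range fun i => V.not (φ i)) < ℵ₁ := by
    rw [← Function.comp_def, Set.range_comp]
    exact Cardinal.mk_image_le.trans_lt hφ
  induction φ with
  | atom φ =>
    have : Countable {ε : ℝ // ε ∈ V.D ∧ 0 < ε} := (hD.mono fun _ h => h.1).to_subtype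
    refine ⟨Cardinal.lt_aleph_one_iff.2 (Cardinal.le_aleph0_iff_set_countable.2
      (Set.countable_range _)),
      ⟨φ.finite_vars.toFinset, fun ε => ?_⟩, fun _ => trivial⟩
    simp only [Formula.free, V.vars_neg, V.vars_appr φ _ ε.down.2.1, Set.Finite.coe_toFinset,
      subset_rfl]
  | all x φ ih => exact ih h
  | ex x φ ih => exact ih h
  | conj ι φ ih | disj ι φ ih =>
    obtain ⟨hcard, ⟨F, hF⟩, hlogic⟩ := h
    exact ⟨hrange φ hcard, ⟨F, fun i => (V.free_not_subset _).trans (hF i)⟩,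
      fun i => ih i (hlogic i)⟩

theorem inFirst_imp (hD : V.D.Countable) {n : ℕ} {φ ψ : Formula L} (hφ : φ.InFirst n)
    (hψ : ψ.InFirst n) : (V.imp φ ψ).InFirst n :=
  Formula.InFirst.or ⟨inLogic_not hD hφ.1, (V.free_not_subset φ).trans hφ.2⟩ hψ

theorem IsMinimalDense.countable (hS : V.IsMinimalDense A S) (hA : V.IsSeparable A) :
    S.Countable := by
  let _ := V.metric A
  have : TopologicalSpace.SeparableSpace A.1 := hA
  obtain ⟨T, hT, hTd⟩ := TopologicalSpace.exists_countable_dense A.1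
  exact Cardinal.le_aleph0_iff_set_countable.1
    ((hS.2 T hTd).trans (Cardinal.le_aleph0_iff_set_countable.2 hT))

end Approximations

theorem inFirst_gameFormula [Countable L.Symbols] (hD : V.D.Countable) (hSc : S.Countable)
    (ε : ℝ) {α : Ordinal.{u}} (hα : α < ω₁) (P : List (Mark A.1)) :
    (gameFormula G ε S α P).InFirst P.length := by
  have := hSc.to_subtype
  have : Countable {e : ℝ // e ∈ V.D ∧ ε < e} := (hD.mono fun _ h => h.1).to_subtype
  induction α using Ordinal.limitRecOn generalizing P with
  | zero =>
    rw [gameFormula_zero]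
    -- the index type need not be countable, but there are only countably many atomic formulas
    refine Formula.inFirst_conj_of_countable_range
      ((Set.countable_range Formula.atom).mono ?_) fun q => ⟨trivial, fun x hx => ?_⟩
    · rintro _ ⟨q, rfl⟩
      exact ⟨_, rfl⟩
    · obtain ⟨y, rfl⟩ := Atom.vars_rename_subset _ _ hx
      exact Fin.is_lt _
  | add_one α ih =>
    rw [gameFormula_add_one]
    have hψ (a : S) (e : {e : ℝ // e ∈ V.D ∧ ε < e}) (k : ℕ) :
        (gameFormula G ε S α (P ++ [⟨a.1, e.1, k⟩])).InFirst (P.length + 1) := by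
      have h := ih ((lt_add_one α).trans hα) (P ++ [⟨a.1, e.1, k⟩])
      rwa [List.length_append] at h
    exact Formula.inFirst_conjSmall fun e => Formula.inFirst_conjSmall fun k =>
      (Formula.inFirst_conj fun a => (hψ a e k).ex).and
        (Formula.inFirst_disj fun a => hψ a e k).all
  | limit α hlim ih =>
    rw [gameFormula_limit hlim]
    have : Countable α.ToType := by
      rwa [← Cardinal.mk_le_aleph0_iff, Cardinal.mk_toType, ← Cardinal.lt_aleph_one_iff,
        ← Cardinal.lt_ord, Cardinal.ord_aleph]
    exact Formula.inFirst_conj fun β => ih _ β.toOrd.2 (lt_trans β.toOrd.2 hα) P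

theorem isSentenceOf_scottSentence [Countable L.Symbols] {Q : Set ℝ} (hD : V.D.Countable)
    (hQ : Q.Countable) (hS : S.Nonempty) (hSc : S.Countable) :
    (scottSentence G Q S).IsSentenceOf ℵ₁ := by
  have hρ : innerScottRank G Q S < ω₁ := innerScottRank_lt_omega_one hD hQ hS hSc
  have hρ' : innerScottRank G Q S + 1 < ω₁ := (Cardinal.isSuccLimit_omega 1).add_one_lt hρ
  have hψ (ε : ℝ) {α : Ordinal.{u}} (hα : α < ω₁) {n : ℕ} (m : Fin n → Mark A.1) :
      (gameFormula G ε S α (List.ofFn m)).InFirst n := by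
    simpa only [List.length_ofFn] using inFirst_gameFormula (G := G) hD hSc ε hα (List.ofFn m)
  have := hSc.to_subtype
  have (p : ℝ → Prop) : Countable {e : ℝ // e ∈ V.D ∧ p e} :=
    (hD.mono fun _ h => h.1).to_subtype
  exact Formula.InFirst.isSentenceOf <|
    Formula.inFirst_conjSmall fun ε => (inFirst_gameFormula hD hSc ε hρ []).and <|
    Formula.inFirst_conjSmall fun n => Formula.inFirst_conjSmall fun e =>
    Formula.inFirst_conjSmall fun k => Formula.inFirst_conjSmall fun ε' =>
    Formula.inFirst_conjSmall fun e' => Formula.inFirst_conj fun a =>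
    (Approximations.inFirst_imp hD (hψ ε hρ _) (hψ ε' hρ' _)).allFirst

end CountableLogic

end MetricScott

end

theorem mainTheorem2_general {L : FirstOrder.Language.{u, u}} {K : Set (Bundled.{u} L.Structure)}
    (V : MetricScott.Approximations L K) (I : MetricScott.IsoNotion V)
    (G : MetricScott.GoodSets V) (A B : K)
    (Q : Set ℝ) (hQ : Q ⊆ V.D)
    (hQd : ∀ x y : ℝ, 0 ≤ x → x < y → ∃ q ∈ Q, x < q ∧ q < y)
    (S : Set A.1) (hS : V.IsDense A S) :
    (MetricScott.Formula.Models B.1 (MetricScott.scottSentence G Q S) ↔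
        ∀ ε : ℝ, 0 < ε → (MetricScott.longGame G ε A B).IIWins) ∧
      (V.IsSeparable A → V.IsSeparable B →
        (MetricScott.Formula.Models B.1 (MetricScott.scottSentence G Q S) ↔
            ∀ ε ∈ V.D, 0 < ε → ∃ f, f ∈ I.mem ε A B) ∧
          (MetricScott.Formula.Models B.1 (MetricScott.scottSentence G Q S) ↔
            I.isoDist A B = 0)) ∧
      (S.Countable → L.card ≤ ℵ₀ → V.D.Countable →
        (MetricScott.scottSentence G Q S).IsSentenceOf (ℵ_ 1)) := by
  have hgame := MetricScott.models_scottSentence_iff_iiWins (G := G) (B := B) hQ hQd hS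
  refine ⟨hgame, fun hA hB => ?_, fun hSc hL hD => ?_⟩
  · rw [I.isoDist_eq_zero_iff, and_self, hgame]
    refine ⟨fun h ε hε h0 => MetricScott.exists_mem_of_iiWins I hA hB hε (h ε h0),
      fun h ε h0 => ?_⟩
    obtain ⟨δ, hδ, hδ0, hδε⟩ := V.D_dense 0 ε le_rfl h0
    obtain ⟨f, hf⟩ := h δ hδ hδ0
    exact MetricScott.iiWins_longGame_of_mem I hδ hδε hf
  · have : Countable L.Symbols := Cardinal.mk_le_aleph0_iff.1 hL
    exact MetricScott.isSentenceOf_scottSentence hD (hD.mono hQ) hS.nonempty hSc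

theorem mainTheorem2 {L : FirstOrder.Language.{u, u}} {K : Set (Bundled.{u} L.Structure)}
    (V : MetricScott.Approximations L K) (I : MetricScott.IsoNotion V)
    (G : MetricScott.GoodSets V) (A B : K)
    (Q : Set ℝ) (hQ : Q ⊆ V.D)
    (hQd : ∀ x y : ℝ, 0 ≤ x → x < y → ∃ q ∈ Q, x < q ∧ q < y)
    (S : Set A.1) (hS : V.IsMinimalDense A S) :
    (MetricScott.Formula.Models B.1 (MetricScott.scottSentence G Q S) ↔
        ∀ ε : ℝ, 0 < ε → (MetricScott.longGame G ε A B).IIWins) ∧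
      (V.IsSeparable A → V.IsSeparable B →
        (MetricScott.Formula.Models B.1 (MetricScott.scottSentence G Q S) ↔
            ∀ ε ∈ V.D, 0 < ε → ∃ f, f ∈ I.mem ε A B) ∧
          (MetricScott.Formula.Models B.1 (MetricScott.scottSentence G Q S) ↔
            I.isoDist A B = 0)) ∧
      (V.IsSeparable A → L.card ≤ ℵ₀ → V.D.Countable →
        (MetricScott.scottSentence G Q S).IsSentenceOf (ℵ_ 1)) := by
  obtain ⟨hgame, hsep, hlogic⟩ := mainTheorem2_general V I G A B Q hQ hQd S hS.1
  exact ⟨hgame, hsep, fun hA => hlogic (hS.countable hA)⟩
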